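/- **Setting.** Let $n_1,n_2\ge 2$ be integers, $\delta\in(0,2)$, $\delta\neq 1$, $p\in(0,1/2)$, and let $\eta_1\in\{\pm1\}^{n_1}$, $\eta_2\in\{\pm1\}^{n_2}$ be label vectors. Let $n_{i+}$ and $n_{i-}$ be the numbers of entries of $\eta_i$ equal to $+1$ and $-1$, and let $\gamma_1,\gamma_2\in(0,1)$ satisfy $|n_{i+}-n_{i-}|/n_i\le\gamma_i$ for $i=1,2$. The observed random matrix $A\in\{0,1\}^{n_1\times n_2}$ follows the bipartite stochastic block model: its entries are independent, $A_{ij}$ is Bernoulli with parameter $\delta p$ if $\eta_{1i}=\eta_{2j}$, and Bernoulli with parameter $(2-\delta)p$ if $\eta_{1i}\ne\eta_{2j}$. Put $\hat p=\frac1{n_1n_2}\sum_{i,j}A_{ij}$ and $\hat A=A-\hat p\,\mathbf 1_{n_1}\mathbf 1_{n_2}^\top$, and let $H(M)=M-\mathrm{diag}(M)$ be the operator that sets the diagonal of a square matrix to zero. For a vector $x$ let $\mathrm{sign}(x)$ be the vector of signs of its entries, with values in $\{\pm1\}$; the sign of $0$ is an arbitrarily fixed element of $\{\pm1\}$. Let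 $\hat v$ be an eigenvector of $H(\hat A\hat A^\top)$ for its largest eigenvalue (any choice, as a function of $A$), and define the hollowed Lloyd iterates with spectral initialization by $$\hat\eta^0=\mathrm{sign}(\hat v),\qquad \hat\eta^{k+1}=\mathrm{sign}\big(H(\hat A\hat A^\top)\,\hat\eta^k\big),\quad k=0,1,2,\dots$$ Let $r(\eta_1,\hat\eta)=\min_{\nu\in\{-1,1\}}\sum_{i=1}^{n_1}|\hat\eta_i-\nu\eta_{1i}|$. **Theorem.** There is an absolute constant $C>0$ such that, if $$\gamma_1\gamma_2\le\frac1{480},\qquad p\ \ge\ C(\delta-1)^{-2}\left(\sqrt{\frac{\log n_1}{n_1n_2}}\ \vee\ \frac{\log n_1}{n_2}\right),$$ then $\hat\eta^m$ with $m>\frac{\log n_1}{2\log 2}-\frac32$ achieves exact recovery of $\eta_1$: $\mathbb P\big(r(\eta_1,\hat\eta^m)=0\big)\to1$ as $n_1\to\infty$. The convergence is uniform over everything else: for every $\varepsilon>0$ there is $N$ such that for all $n_1\ge N$, all $n_2,\delta,p,\gamma_1,\gamma_2,\eta_1,\eta_2$ as above that satisfy the two conditions, every choice of $\hat v$ and of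 the sign of $0$, and every integer $m\ge0$ with $m>\frac{\log n_1}{2\log 2}-\frac32$, one has $\mathbb P\big(r(\eta_1,\hat\eta^m)=0\big)\ge1-\varepsilon$. -/

import Mathlib

open MeasureTheory ProbabilityTheory

noncomputable section

namespace BSBM

/-- A vector of community labels: every entry is `+1` or `-1`. -/
def IsLabeling {n : ℕ} (η : Fin n → ℝ) : Prop :=
  ∀ i, η i = 1 ∨ η i = -1

/-- Imbalance `|n₊ - n₋| / n` of a labelled set of `n` vertices, where `n₊` and `n₋` are the
numbers of vertices with label `+1` and `-1`. -/
def imbalance {n : ℕ} (η : Fin n → ℝ) : ℝ :=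
  |({i : Fin n | η i = 1}.ncard : ℝ) - ({i : Fin n | η i = -1}.ncard : ℝ)| / (n : ℝ)

/-- The random biadjacency matrix `A` is drawn from the bipartite stochastic block model with
label vectors `η₁`, `η₂` and parameters `δ`, `p`: its entries are independent, with values in
`{0, 1}`, and `A i j` is Bernoulli with parameter `δ p` if the labels of `i` and `j` agree, and
with parameter `(2 - δ) p` if they differ. -/
structure IsBSBM {Ω : Type*} [MeasurableSpace Ω] (P : Measure Ω) {n₁ n₂ : ℕ}
    (A : Ω → Matrix (Fin n₁) (Fin n₂) ℝ) (η₁ : Fin n₁ → ℝ) (η₂ : Fin n₂ → ℝ)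
    (δ p : ℝ) : Prop where
  measurable_entry : ∀ i j, Measurable fun ω => A ω i j
  entry_eq : ∀ ω i j, A ω i j = 0 ∨ A ω i j = 1
  indep : iIndepFun (fun (e : Fin n₁ × Fin n₂) (ω : Ω) => A ω e.1 e.2) P
  prob_same : ∀ i j, η₁ i = η₂ j → P {ω | A ω i j = 1} = ENNReal.ofReal (δ * p)
  prob_diff : ∀ i j, η₁ i ≠ η₂ j → P {ω | A ω i j = 1} = ENNReal.ofReal ((2 - δ) * p)

/-- The `ℓ₁`-distance between two vectors. -/
def l1Dist {n : ℕ} (x y : Fin n → ℝ) : ℝ :=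
  ∑ i, |x i - y i|

/-- The loss `r(η, η') = min_{ν = ±1} |η' - ν η|`. -/
def loss {n : ℕ} (η η' : Fin n → ℝ) : ℝ :=
  min (l1Dist η' η) (l1Dist η' (-η))

/-- The estimator `p̂` of the edge density: the average of the entries of `A`. -/
def pHat {n₁ n₂ : ℕ} (A : Matrix (Fin n₁) (Fin n₂) ℝ) : ℝ :=
  1 / ((n₁ : ℝ) * (n₂ : ℝ)) * ∑ i, ∑ j, A i j

/-- The corrected matrix `Â = A - p̂ 1 1ᵀ`. -/
def corrected {n₁ n₂ : ℕ} (A : Matrix (Fin n₁) (Fin n₂) ℝ) : Matrix (Fin n₁) (Fin n₂) ℝ :=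
  A - Matrix.of fun _ _ => pHat A

/-- The hollowing operator `H(M) = M - diag(M)`. -/
def hollow {n : ℕ} (M : Matrix (Fin n) (Fin n) ℝ) : Matrix (Fin n) (Fin n) ℝ :=
  M - Matrix.diagonal M.diag

/-- The hollowed Gram matrix `H(Â Âᵀ)`. -/
def hollowedGram {n₁ n₂ : ℕ} (A : Matrix (Fin n₁) (Fin n₂) ℝ) : Matrix (Fin n₁) (Fin n₁) ℝ :=
  hollow (corrected A * (corrected A).transpose)

/-- `v` is an eigenvector of `M` for its largest (real) eigenvalue. -/
def IsTopEigenvector {n : ℕ} (M : Matrix (Fin n) (Fin n) ℝ) (v : Fin n → ℝ) : Prop :=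
  ∃ lam : ℝ, Module.End.HasEigenvector (Matrix.toLin' M) lam v ∧
    ∀ μ : ℝ, Module.End.HasEigenvalue (Matrix.toLin' M) μ → μ ≤ lam

/-- The sign of a real number, with the convention that the sign of `0` is `s₀`. -/
def sgn (s₀ x : ℝ) : ℝ :=
  if 0 < x then 1 else if x < 0 then -1 else s₀

/-- The vector of the signs of the entries of a vector. -/
def signVec {n : ℕ} (s₀ : ℝ) (x : Fin n → ℝ) : Fin n → ℝ :=
  fun i => sgn s₀ (x i)

/-- The hollowed Lloyd iterates for the data matrix `A`, started from the signs of `v`: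
`η̂⁰ = sign(v)` and `η̂ᵏ⁺¹ = sign(H(Â Âᵀ) η̂ᵏ)`. -/
def lloyd {n₁ n₂ : ℕ} (s₀ : ℝ) (A : Matrix (Fin n₁) (Fin n₂) ℝ) (v : Fin n₁ → ℝ) :
    ℕ → Fin n₁ → ℝ
  | 0 => signVec s₀ v
  | k + 1 => signVec s₀ ((hollowedGram A).mulVec (lloyd s₀ A v k))

end BSBM

end

/-! Put n = n₁, a = (δ-1)p and s = a²n₂, and write A = N + p11ᵀ + aη₁η₂ᵀ with N centred with
independent entries. Then H(ÂÂᵀ) = sη₁η₁ᵀ + D + S, where S = H(NNᵀ) has mean zero thanks to the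
hollowing, and D collects the cross terms of signal and noise, the error of p̂ and the missing
diagonal of the signal. The error of p̂ is small relative to a because γ₁γ₂ ≤ 1/480.

The rest of the argument about the algorithm is deterministic (`loss_lloyd_eq_zero`). Suppose ‖S‖ ≤
sn/500, every entry of Sη₁ is at most sn/500 in modulus, and D is entrywise at most s/64, plus s on
the diagonal. The top eigenvector is then nearly parallel to η₁, so its signs have at most n/8
errors up to a global sign ν. For an iterate x = νη₁ + z, the signal beats D and Sη₁ in every
coordinate, so a wrong sign at i forces |(Sz)ᵢ| ≥ sn/2; since |Sz|² ≤ ‖S‖²|z|² and |z|² is four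
times the number of errors, each step divides that number by at least four. The bound is uniform in
x, so the dependence of the iterates on A is harmless. The condition on m says exactly that
n/(8·4^m) < 1, and an integer below 1 is 0.

The bounds on S, Sη₁ and N come from exponential moments. S is a sum over the n₂ independent columns
w of N of the matrices H(wwᵀ). Golden-Thompson reduces the trace of exp(rS) to one column at a time
(`sum_prod_mul_trace_exp_le`). For one column, ‖H(wwᵀ)‖ is controlled by the random quantity Σ|wᵢ|
rather than by a constant, and the weight exp(θΣ|wᵢ|) factorises over the rows
(`sum_columnWeight_mul_sq_mul_exp_le`). Golden-Thompson itself follows from Lieb-Thirring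
inequalities for powers of two and the Lie product formula. -/

namespace BSBM

/-! ### Trace inequalities for powers of products -/

section GoldenThompson

variable {ι : Type*} [Fintype ι]

open Matrix

theorem trace_mul_transpose_nonneg (M : Matrix ι ι ℝ) : 0 ≤ (M * Mᵀ).trace := by
  simp only [Matrix.trace, Matrix.diag, Matrix.mul_apply, Matrix.transpose_apply]
  exact Finset.sum_nonneg fun i _ => Finset.sum_nonneg fun j _ => mul_self_nonneg _

/-- Cauchy-Schwarz (with the arithmetic mean) for the trace inner product. -/
theorem two_mul_trace_mul_transpose_le (M N : Matrix ι ι ℝ) :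
    2 * (M * Nᵀ).trace ≤ (M * Mᵀ).trace + (N * Nᵀ).trace := by
  have h := trace_mul_transpose_nonneg (M - N)
  have hs : (N * Mᵀ).trace = (M * Nᵀ).trace := by
    rw [← Matrix.trace_transpose (N * Mᵀ)]
    simp
  simp only [Matrix.transpose_sub, Matrix.sub_mul, Matrix.mul_sub, Matrix.trace_sub] at h
  linarith

theorem trace_sq_le (M : Matrix ι ι ℝ) : (M * M).trace ≤ (M * Mᵀ).trace := by
  have h := two_mul_trace_mul_transpose_le M Mᵀ
  rw [Matrix.transpose_transpose, Matrix.trace_mul_comm Mᵀ M] at h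
  linarith

variable [DecidableEq ι]

theorem trace_mul_pow_comm (M N : Matrix ι ι ℝ) (k : ℕ) :
    ((M * N) ^ k).trace = ((N * M) ^ k).trace := by
  cases k with
  | zero => simp
  | succ k =>
    rw [pow_succ, ← Matrix.mul_assoc, Matrix.trace_mul_comm, ← Matrix.mul_assoc]
    rw [pow_succ' (N * M)]
    congr 1
    rw [Matrix.mul_assoc N M, Matrix.mul_assoc]
    congr 1
    have : SemiconjBy M (N * M) (M * N) := by simp [SemiconjBy, mul_assoc]
    exact (this.pow_right k).eq.symm

/-- Lieb-Thirring type trace inequalities for exponents that are powers of two. -/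
theorem trace_pow_two_pow_le (k : ℕ) :
    (∀ P Q : Matrix ι ι ℝ, P.IsSymm → Q.IsSymm →
      ((P * Q) ^ 2 ^ k).trace ≤ (P ^ 2 ^ k * Q ^ 2 ^ k).trace) ∧
    (∀ M : Matrix ι ι ℝ, (M ^ 2 ^ k * (M ^ 2 ^ k)ᵀ).trace ≤ ((M * Mᵀ) ^ 2 ^ k).trace) := by
  induction k with
  | zero => simp
  | succ k ih =>
    obtain ⟨hA, hB⟩ := ih
    -- The two claims feed each other: the first at k+1 uses both at k, with Q² and P² in place of P
    -- and Q; the second at k+1 uses the second for M² and then the first for MᵀM and MMᵀ.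
    refine ⟨fun P Q hP hQ => ?_, fun M => ?_⟩
    · calc ((P * Q) ^ 2 ^ (k + 1)).trace
          = ((P * Q) ^ 2 ^ k * (P * Q) ^ 2 ^ k).trace := by rw [← pow_add, pow_succ, mul_two]
        _ ≤ ((P * Q) ^ 2 ^ k * ((P * Q) ^ 2 ^ k)ᵀ).trace := trace_sq_le _
        _ ≤ ((P * Q * (P * Q)ᵀ) ^ 2 ^ k).trace := hB _
        _ = ((P * (Q ^ 2 * P)) ^ 2 ^ k).trace := by
            rw [Matrix.transpose_mul, hP.eq, hQ.eq]; simp [mul_assoc, pow_two]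
        _ = ((Q ^ 2 * P ^ 2) ^ 2 ^ k).trace := by
            rw [trace_mul_pow_comm]; simp [mul_assoc, pow_two]
        _ ≤ ((Q ^ 2) ^ 2 ^ k * (P ^ 2) ^ 2 ^ k).trace := hA _ _ (hQ.pow 2) (hP.pow 2)
        _ = (P ^ 2 ^ (k + 1) * Q ^ 2 ^ (k + 1)).trace := by
            rw [Matrix.trace_mul_comm, ← pow_mul, ← pow_mul, ← pow_succ']
    · have h1 : (Mᵀ * M).IsSymm := Matrix.isSymm_transpose_mul_self M
      have h2 : (M * Mᵀ).IsSymm := Matrix.isSymm_mul_transpose_self M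
      -- Powers of MᵀM and MMᵀ have equal traces, so the arithmetic mean collapses to a single
      -- trace.
      have h3 := two_mul_trace_mul_transpose_le ((Mᵀ * M) ^ 2 ^ k) ((M * Mᵀ) ^ 2 ^ k)
      rw [(h1.pow _).eq, (h2.pow _).eq, ← pow_add, ← pow_add, trace_mul_pow_comm Mᵀ M,
        ← two_mul, ← two_mul, ← pow_succ'] at h3
      calc (M ^ 2 ^ (k + 1) * (M ^ 2 ^ (k + 1))ᵀ).trace
          = ((M ^ 2) ^ 2 ^ k * ((M ^ 2) ^ 2 ^ k)ᵀ).trace := by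
            rw [← pow_mul, ← pow_succ']
        _ ≤ ((M ^ 2 * (M ^ 2)ᵀ) ^ 2 ^ k).trace := hB _
        _ = ((M * (M * Mᵀ * Mᵀ)) ^ 2 ^ k).trace := by
            rw [Matrix.transpose_pow]; simp [mul_assoc, pow_two]
        _ = ((M * Mᵀ * (Mᵀ * M)) ^ 2 ^ k).trace := by
            rw [trace_mul_pow_comm]; simp [mul_assoc]
        _ = ((Mᵀ * M * (M * Mᵀ)) ^ 2 ^ k).trace := by rw [trace_mul_pow_comm]
        _ ≤ ((Mᵀ * M) ^ 2 ^ k * (M * Mᵀ) ^ 2 ^ k).trace := hA _ _ h1 h2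
        _ ≤ ((M * Mᵀ) ^ 2 ^ (k + 1)).trace := by linarith

end GoldenThompson

/-! ### The Lie product formula -/

section LieTrotter

open NormedSpace Filter Topology

variable {𝔸 : Type*} [NormedRing 𝔸] [NormOneClass 𝔸]

/-- Telescoping. Since b ≥ 1, the exponent n - 1 may be relaxed to n, which avoids a case
distinction. -/
theorem norm_pow_sub_pow_le {x y : 𝔸} {b : ℝ} (hx : ‖x‖ ≤ b) (hy : ‖y‖ ≤ b) (hb : 1 ≤ b)
    (n : ℕ) : ‖x ^ n - y ^ n‖ ≤ n * b ^ n * ‖x - y‖ := by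
  induction n with
  | zero => simp
  | succ n ih =>
    have e : x ^ (n + 1) - y ^ (n + 1) = (x ^ n - y ^ n) * x + y ^ n * (x - y) := by
      rw [pow_succ, pow_succ]; noncomm_ring
    have hyn : ‖y ^ n‖ ≤ b ^ (n + 1) :=
      (norm_pow_le _ _).trans ((pow_le_pow_left₀ (norm_nonneg _) hy n).trans
        (pow_le_pow_right₀ hb n.le_succ))
    calc ‖x ^ (n + 1) - y ^ (n + 1)‖ ≤ ‖x ^ n - y ^ n‖ * ‖x‖ + ‖y ^ n‖ * ‖x - y‖ := by
          rw [e]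
          exact (norm_add_le _ _).trans (add_le_add (norm_mul_le _ _) (norm_mul_le _ _))
      _ ≤ n * b ^ n * ‖x - y‖ * b + b ^ (n + 1) * ‖x - y‖ := by gcongr
      _ = ((n + 1 : ℕ) : ℝ) * b ^ (n + 1) * ‖x - y‖ := by push_cast; ring

variable [NormedAlgebra ℝ 𝔸] [CompleteSpace 𝔸]

theorem norm_exp_le_exp_norm (x : 𝔸) : ‖exp x‖ ≤ Real.exp ‖x‖ := by
  have h1 := exp_series_hasSum_exp' (𝕂 := ℝ) x
  have h2 : HasSum (fun n : ℕ => (n.factorial⁻¹ : ℝ) • ‖x‖ ^ n) (Real.exp ‖x‖) := by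
    rw [Real.exp_eq_exp_ℝ]
    exact exp_series_hasSum_exp' (𝕂 := ℝ) ‖x‖
  rw [← h1.tsum_eq, ← h2.tsum_eq]
  refine tsum_of_norm_bounded h2.summable.hasSum fun n => ?_
  rw [norm_smul, Real.norm_of_nonneg (by positivity), smul_eq_mul]
  gcongr
  exact norm_pow_le _ _

/-- The Lie product formula. -/
theorem tendsto_exp_mul_exp_pow (a b : 𝔸) :
    Tendsto (fun n : ℕ => (exp ((n : ℝ)⁻¹ • a) * exp ((n : ℝ)⁻¹ • b)) ^ n) atTop
      (𝓝 (exp (a + b))) := by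
  -- Both curves have the same first-order term at 0, so their difference at 1/n is o(1/n); this
  -- absorbs the factor n from telescoping.
  have hd : HasDerivAt (fun t : ℝ => exp (t • a) * exp (t • b) - exp (t • (a + b))) 0 0 := by
    have h := ((hasDerivAt_exp_smul_const (𝕂 := ℝ) a (0 : ℝ)).mul
      (hasDerivAt_exp_smul_const (𝕂 := ℝ) b (0 : ℝ))).sub
      (hasDerivAt_exp_smul_const (𝕂 := ℝ) (a + b) (0 : ℝ))
    refine HasDerivAt.congr_deriv (f' := _) h ?_
    simp
  have hs : Tendsto (fun n : ℕ => (n : ℝ) * ‖exp ((n : ℝ)⁻¹ • a) * exp ((n : ℝ)⁻¹ • b) -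
      exp ((n : ℝ)⁻¹ • (a + b))‖) atTop (𝓝 0) := by
    have h1 := (hasDerivAt_iff_tendsto_slope_zero.1 hd)
    have h2 : Tendsto (fun n : ℕ => ((n : ℝ))⁻¹) atTop (𝓝[≠] 0) := by
      refine tendsto_nhdsWithin_iff.2 ⟨tendsto_inv_atTop_nhds_zero_nat, ?_⟩
      filter_upwards [eventually_gt_atTop 0] with n hn
      simp [hn.ne']
    have h3 := (h1.comp h2).norm
    refine (h3.congr fun n => ?_).trans (by simp)
    simp [norm_smul]
  have hb : ∀ n : ℕ, 0 < n → ‖(exp ((n : ℝ)⁻¹ • a) * exp ((n : ℝ)⁻¹ • b)) ^ n - exp (a + b)‖ ≤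
      Real.exp (‖a‖ + ‖b‖) * ((n : ℝ) * ‖exp ((n : ℝ)⁻¹ • a) * exp ((n : ℝ)⁻¹ • b) -
      exp ((n : ℝ)⁻¹ • (a + b))‖) := by
    intro n hn
    have hn' : (n : ℝ) ≠ 0 := by positivity
    have e : exp (a + b) = exp ((n : ℝ)⁻¹ • (a + b)) ^ n := by
      let : NormedAlgebra ℚ 𝔸 := .restrictScalars ℚ ℝ 𝔸
      rw [← exp_nsmul, ← Nat.cast_smul_eq_nsmul ℝ, smul_smul, mul_inv_cancel₀ hn', one_smul]
    have hns : ∀ z : 𝔸, ‖(n : ℝ)⁻¹ • z‖ = (n : ℝ)⁻¹ * ‖z‖ := fun z => by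
      rw [norm_smul, Real.norm_of_nonneg (by positivity)]
    have h1 : ‖exp ((n : ℝ)⁻¹ • a) * exp ((n : ℝ)⁻¹ • b)‖ ≤
        Real.exp ((n : ℝ)⁻¹ * (‖a‖ + ‖b‖)) := by
      refine (norm_mul_le _ _).trans ?_
      rw [mul_add, Real.exp_add, ← hns, ← hns]
      gcongr <;> exact norm_exp_le_exp_norm _
    have h2 : ‖exp ((n : ℝ)⁻¹ • (a + b))‖ ≤ Real.exp ((n : ℝ)⁻¹ * (‖a‖ + ‖b‖)) := by
      refine (norm_exp_le_exp_norm _).trans ?_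
      rw [hns]
      gcongr
      exact norm_add_le _ _
    rw [e]
    -- The base is exp((‖a‖+‖b‖)/n), whose n-th power does not depend on n.
    refine (norm_pow_sub_pow_le h1 h2 (Real.one_le_exp (by positivity)) n).trans (le_of_eq ?_)
    rw [← Real.exp_nat_mul, ← mul_assoc (n : ℝ) (n : ℝ)⁻¹, mul_inv_cancel₀ hn', one_mul]
    ring
  rw [tendsto_iff_norm_sub_tendsto_zero]
  refine squeeze_zero' (Eventually.of_forall fun _ => norm_nonneg _)
    ((eventually_gt_atTop 0).mono fun n hn => hb n hn) ?_
  simpa using hs.const_mul (Real.exp (‖a‖ + ‖b‖))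

end LieTrotter

/-! ### The Golden-Thompson inequality -/

section GoldenThompson

open Matrix NormedSpace Filter Topology

variable {ι : Type*} [Fintype ι] [DecidableEq ι]

/-- The Golden-Thompson inequality for real symmetric matrices. -/
theorem trace_exp_add_le {A B : Matrix ι ι ℝ} (hA : A.IsSymm) (hB : B.IsSymm) :
    (exp (A + B)).trace ≤ (exp A * exp B).trace := by
  rcases isEmpty_or_nonempty ι with hι | hι
  · simp [Matrix.trace]
  -- The norm serves only to state the limit; norm one for the identity needs a nonempty index type,
  -- hence the case split.
  let _ : NormedRing (Matrix ι ι ℝ) := Matrix.linftyOpNormedRing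
  let _ : NormedAlgebra ℝ (Matrix ι ι ℝ) := Matrix.linftyOpNormedAlgebra
  have _ : NormOneClass (Matrix ι ι ℝ) := Matrix.linfty_opNormOneClass
  have hlim := (tendsto_exp_mul_exp_pow A B).comp
    (tendsto_pow_atTop_atTop_of_one_lt (one_lt_two : 1 < 2))
  have htr : Continuous (Matrix.trace : Matrix ι ι ℝ → ℝ) := continuous_id.matrix_trace
  refine le_of_tendsto ((htr.tendsto _).comp hlim) (Eventually.of_forall fun k => ?_)
  have e : ∀ X : Matrix ι ι ℝ, exp ((((2 ^ k : ℕ) : ℝ))⁻¹ • X) ^ 2 ^ k = exp X := fun X => by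
    rw [← Matrix.exp_nsmul, ← Nat.cast_smul_eq_nsmul ℝ, smul_smul,
      mul_inv_cancel₀ (by positivity), one_smul]
  have h := (trace_pow_two_pow_le k).1 (exp ((((2 ^ k : ℕ) : ℝ))⁻¹ • A))
    (exp ((((2 ^ k : ℕ) : ℝ))⁻¹ • B)) (hA.smul _).exp (hB.smul _).exp
  rwa [e, e] at h

end GoldenThompson

end BSBM

/-! ### Quadratic forms and exponentials of symmetric matrices -/

namespace BSBM

/-- The linear term is kept exactly, so that it vanishes after averaging a centred variable. -/
theorem exp_le_one_add_add_sq_mul_exp_abs (x : ℝ) :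
    Real.exp x ≤ 1 + x + x ^ 2 * Real.exp |x| := by
  have h := Complex.norm_exp_sub_sum_le_norm_mul_exp x 2
  have e : Complex.exp x - ∑ m ∈ Finset.range 2, (x : ℂ) ^ m / m.factorial =
      ((Real.exp x - (1 + x) : ℝ) : ℂ) := by
    simp [Finset.sum_range_succ]
  rw [e, Complex.norm_real, Complex.norm_real, Real.norm_eq_abs, Real.norm_eq_abs, sq_abs] at h
  linarith [le_abs_self (Real.exp x - (1 + x))]

section Spectral

open Matrix NormedSpace

variable {ι : Type*} [Fintype ι] [DecidableEq ι]

theorem exists_orthogonal_diagonalization {M : Matrix ι ι ℝ} (hM : M.IsSymm) :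
    ∃ (l : ι → ℝ) (U : Matrix ι ι ℝ), U * Uᵀ = 1 ∧ Uᵀ * U = 1 ∧ M = U * diagonal l * Uᵀ := by
  have hH : M.IsHermitian := by
    rw [Matrix.IsHermitian, Matrix.conjTranspose_eq_transpose_of_trivial, hM.eq]
  have hstar : ∀ X : Matrix ι ι ℝ, star X = Xᵀ := fun X => by
    rw [Matrix.star_eq_conjTranspose, Matrix.conjTranspose_eq_transpose_of_trivial]
  refine ⟨hH.eigenvalues, hH.eigenvectorUnitary, ?_, ?_, ?_⟩
  · rw [← hstar]; exact Unitary.coe_mul_star_self hH.eigenvectorUnitary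
  · rw [← hstar]; exact Unitary.coe_star_mul_self hH.eigenvectorUnitary
  · have h := hH.spectral_theorem
    rw [Unitary.conjStarAlgAut_apply, hstar] at h
    exact h

theorem dotProduct_conj_diagonal_mulVec (U : Matrix ι ι ℝ) (l x : ι → ℝ) :
    x ⬝ᵥ (U * diagonal l * Uᵀ) *ᵥ x = ∑ i, l i * (Uᵀ *ᵥ x) i ^ 2 := by
  rw [← Matrix.mulVec_mulVec, ← Matrix.mulVec_mulVec, Matrix.dotProduct_mulVec,
    ← Matrix.mulVec_transpose]
  simp only [dotProduct, Matrix.mulVec_diagonal]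
  exact Finset.sum_congr rfl fun i _ => by ring

theorem dotProduct_mulVec_self_of_orthogonal {U : Matrix ι ι ℝ} (hU : U * Uᵀ = 1) (x : ι → ℝ) :
    ∑ i, (Uᵀ *ᵥ x) i ^ 2 = x ⬝ᵥ x := by
  have h := dotProduct_conj_diagonal_mulVec U (fun _ => 1) x
  have h1 : (diagonal fun _ : ι => (1 : ℝ)) = 1 := Matrix.diagonal_one
  rw [h1, mul_one, hU, Matrix.one_mulVec] at h
  rw [h]
  simp

theorem exp_conj_diagonal {U : Matrix ι ι ℝ} (hU : U * Uᵀ = 1) (l : ι → ℝ) :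
    exp (U * diagonal l * Uᵀ) = U * diagonal (fun i => Real.exp (l i)) * Uᵀ := by
  have hinv : U⁻¹ = Uᵀ := Matrix.inv_eq_right_inv hU
  have hunit : IsUnit U := IsUnit.of_mul_eq_one _ hU
  rw [← hinv, Matrix.exp_conj U _ hunit, Matrix.exp_diagonal]
  congr 3
  funext i
  rw [Pi.exp_def, Real.exp_eq_exp_ℝ]

/-- The columns of U serve as unit test vectors that turn bounds on a quadratic form into bounds on
eigenvalues. -/
theorem eigenvalue_eq_dotProduct {U : Matrix ι ι ℝ} (hU : Uᵀ * U = 1) (l : ι → ℝ) (i : ι) :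
    (U *ᵥ Pi.single i 1) ⬝ᵥ (U * diagonal l * Uᵀ) *ᵥ (U *ᵥ Pi.single i 1) = l i ∧
    (U *ᵥ Pi.single i 1) ⬝ᵥ (U *ᵥ Pi.single i 1) = 1 := by
  have h : ∀ l' : ι → ℝ, (U *ᵥ Pi.single i 1) ⬝ᵥ (U * diagonal l' * Uᵀ) *ᵥ (U *ᵥ Pi.single i 1)
      = l' i := fun l' => by
    rw [dotProduct_conj_diagonal_mulVec, Matrix.mulVec_mulVec, hU, Matrix.one_mulVec]
    rw [Finset.sum_eq_single i (fun j _ hj => by simp [hj]) (by simp)]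
    simp
  refine ⟨h l, ?_⟩
  have h1 : (diagonal fun _ : ι => (1 : ℝ)) = 1 := Matrix.diagonal_one
  have h2 := h fun _ => 1
  rwa [h1, mul_one, mul_eq_one_comm.1 hU, Matrix.one_mulVec] at h2

theorem mulVec_dotProduct_self_conj_diagonal {U : Matrix ι ι ℝ} (hU : Uᵀ * U = 1) (l x : ι → ℝ) :
    (U * diagonal l * Uᵀ) *ᵥ x ⬝ᵥ (U * diagonal l * Uᵀ) *ᵥ x =
      ∑ i, l i ^ 2 * (Uᵀ *ᵥ x) i ^ 2 := by
  have hs : (U * diagonal l * Uᵀ)ᵀ = U * diagonal l * Uᵀ := by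
    simp [Matrix.transpose_mul, Matrix.mul_assoc]
  rw [← dotProduct_conj_diagonal_mulVec U (fun i => l i ^ 2) x]
  conv_lhs => rw [Matrix.dotProduct_mulVec, ← Matrix.mulVec_transpose, hs, Matrix.mulVec_mulVec,
    dotProduct_comm]
  congr 2
  calc U * diagonal l * Uᵀ * (U * diagonal l * Uᵀ)
      = U * diagonal l * (Uᵀ * U) * diagonal l * Uᵀ := by simp only [Matrix.mul_assoc]
    _ = U * diagonal (fun i => l i ^ 2) * Uᵀ := by
        rw [hU, mul_one, Matrix.mul_assoc U, Matrix.diagonal_mul_diagonal]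
        simp [pow_two]

/-- Second-order upper bound for the quadratic form of the exponential of a symmetric matrix. -/
theorem dotProduct_exp_mulVec_le {M : Matrix ι ι ℝ} (hM : M.IsSymm) {b : ℝ}
    (hb : ∀ x, |x ⬝ᵥ M *ᵥ x| ≤ b * (x ⬝ᵥ x)) (x : ι → ℝ) :
    x ⬝ᵥ exp M *ᵥ x ≤
      x ⬝ᵥ x + x ⬝ᵥ M *ᵥ x + Real.exp b * (M *ᵥ x ⬝ᵥ M *ᵥ x) := by
  obtain ⟨l, U, hU, hU', rfl⟩ := exists_orthogonal_diagonalization hM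
  have hl : ∀ i, |l i| ≤ b := fun i => by
    obtain ⟨h1, h2⟩ := eigenvalue_eq_dotProduct hU' l i
    have h := hb (U *ᵥ Pi.single i 1)
    rwa [h1, h2, mul_one] at h
  rw [exp_conj_diagonal hU, mulVec_dotProduct_self_conj_diagonal hU', dotProduct_conj_diagonal_mulVec, dotProduct_conj_diagonal_mulVec,
    ← dotProduct_mulVec_self_of_orthogonal hU x, Finset.mul_sum, ← Finset.sum_add_distrib,
    ← Finset.sum_add_distrib]
  refine Finset.sum_le_sum fun i _ => ?_
  have h1 : Real.exp (l i) ≤ 1 + l i + l i ^ 2 * Real.exp |l i| := exp_le_one_add_add_sq_mul_exp_abs _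
  have h2 : Real.exp |l i| ≤ Real.exp b := Real.exp_le_exp.2 (hl i)
  have h3 : Real.exp (l i) ≤ 1 + l i + l i ^ 2 * Real.exp b := h1.trans (by gcongr)
  nlinarith [mul_le_mul_of_nonneg_right h3 (sq_nonneg ((Uᵀ *ᵥ x) i))]

/-- The trace of the exponential dominates the exponential of each eigenvalue. -/
theorem dotProduct_mulVec_le_of_trace_exp_le {M : Matrix ι ι ℝ} (hM : M.IsSymm) {t : ℝ}
    (h : (exp M).trace ≤ Real.exp t) (x : ι → ℝ) : x ⬝ᵥ M *ᵥ x ≤ t * (x ⬝ᵥ x) := by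
  obtain ⟨l, U, hU, hU', rfl⟩ := exists_orthogonal_diagonalization hM
  have htr : ∑ i, Real.exp (l i) ≤ Real.exp t := by
    rwa [exp_conj_diagonal hU, Matrix.trace_mul_comm, ← Matrix.mul_assoc, hU', one_mul,
      Matrix.trace_diagonal] at h
  have hl : ∀ i, l i ≤ t := fun i => Real.exp_le_exp.1 <|
    (Finset.single_le_sum (f := fun i => Real.exp (l i)) (fun j _ => (Real.exp_pos _).le)
      (Finset.mem_univ i)).trans htr
  rw [dotProduct_conj_diagonal_mulVec, ← dotProduct_mulVec_self_of_orthogonal hU x, Finset.mul_sum]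
  exact Finset.sum_le_sum fun i _ => mul_le_mul_of_nonneg_right (hl i) (sq_nonneg _)

theorem mulVec_dotProduct_mulVec_le {M : Matrix ι ι ℝ} (hM : M.IsSymm) {b : ℝ}
    (hb : ∀ x, |x ⬝ᵥ M *ᵥ x| ≤ b * (x ⬝ᵥ x)) (x : ι → ℝ) :
    M *ᵥ x ⬝ᵥ M *ᵥ x ≤ b ^ 2 * (x ⬝ᵥ x) := by
  obtain ⟨l, U, hU, hU', rfl⟩ := exists_orthogonal_diagonalization hM
  have hl : ∀ i, |l i| ≤ b := fun i => by
    obtain ⟨h1, h2⟩ := eigenvalue_eq_dotProduct hU' l i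
    have h := hb (U *ᵥ Pi.single i 1)
    rwa [h1, h2, mul_one] at h
  rw [mulVec_dotProduct_self_conj_diagonal hU', ← dotProduct_mulVec_self_of_orthogonal hU x, Finset.mul_sum]
  refine Finset.sum_le_sum fun i _ => mul_le_mul_of_nonneg_right ?_ (sq_nonneg _)
  exact sq_le_sq' (abs_le.1 (hl i)).1 (abs_le.1 (hl i)).2

/-- In an eigenbasis of Z the trace is a positively weighted sum of values of the quadratic form of
E. -/
theorem trace_exp_mul_le {Z E : Matrix ι ι ℝ} (hZ : Z.IsSymm) {b : ℝ}
    (hE : ∀ x, x ⬝ᵥ E *ᵥ x ≤ b * (x ⬝ᵥ x)) : (exp Z * E).trace ≤ b * (exp Z).trace := by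
  obtain ⟨l, U, hU, hU', rfl⟩ := exists_orthogonal_diagonalization hZ
  rw [exp_conj_diagonal hU, Matrix.trace_mul_comm (U * _) Uᵀ, ← Matrix.mul_assoc, hU', one_mul,
    Matrix.trace_diagonal, Matrix.mul_assoc, Matrix.mul_assoc, Matrix.trace_mul_comm,
    Matrix.mul_assoc, Finset.mul_sum, Matrix.trace]
  refine Finset.sum_le_sum fun i _ => ?_
  obtain ⟨-, h2⟩ := eigenvalue_eq_dotProduct hU' l i
  have h := hE (U *ᵥ Pi.single i 1)
  have e : (U *ᵥ Pi.single i 1) ⬝ᵥ E *ᵥ (U *ᵥ Pi.single i 1) = (Uᵀ * (E * U)) i i := by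
    rw [Matrix.mulVec_mulVec, dotProduct_comm, Matrix.dotProduct_mulVec, ← Matrix.mulVec_transpose,
      Matrix.mulVec_mulVec]
    simp
  rw [h2, mul_one, e] at h
  rw [Matrix.diag_apply, Matrix.diagonal_mul, Matrix.mul_assoc, mul_comm b]
  exact mul_le_mul_of_nonneg_left h (Real.exp_pos _).le

/-- Every diagonal entry of an orthogonal diagonalization is an eigenvalue, so maximality among
eigenvalues gives the Rayleigh bound. -/
theorem dotProduct_mulVec_le_of_isTopEigenvector {n : ℕ} {M : Matrix (Fin n) (Fin n) ℝ}
    (hM : M.IsSymm) {v : Fin n → ℝ} (hv : IsTopEigenvector M v) :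
    ∃ lam : ℝ, M *ᵥ v = lam • v ∧ v ≠ 0 ∧ ∀ x, x ⬝ᵥ M *ᵥ x ≤ lam * (x ⬝ᵥ x) := by
  obtain ⟨lam, hlam, hmax⟩ := hv
  obtain ⟨l, U, hU, hU', rfl⟩ := exists_orthogonal_diagonalization hM
  refine ⟨lam, by rw [← Matrix.toLin'_apply]; exact hlam.apply_eq_smul, hlam.2, fun x => ?_⟩
  have hl : ∀ i, l i ≤ lam := fun i => by
    refine hmax _ (Module.End.hasEigenvalue_of_hasEigenvector (x := U *ᵥ Pi.single i 1)
      ⟨Module.End.mem_eigenspace_iff.2 ?_, fun h0 => ?_⟩)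
    · rw [Matrix.toLin'_apply, Matrix.mulVec_mulVec, Matrix.mul_assoc, hU', mul_one,
        ← Matrix.mulVec_mulVec, Matrix.diagonal_mulVec_single, mul_one, ← Matrix.mulVec_smul]
      congr 1
      rw [← Pi.single_smul, smul_eq_mul, mul_one]
    · have := (eigenvalue_eq_dotProduct hU' l i).2
      rw [h0] at this
      simp at this
  rw [dotProduct_conj_diagonal_mulVec, ← dotProduct_mulVec_self_of_orthogonal hU x, Finset.mul_sum]
  exact Finset.sum_le_sum fun i _ => mul_le_mul_of_nonneg_right (hl i) (sq_nonneg _)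

end Spectral

/-! ### The matrix Laplace transform method -/

section MatrixLaplace

open Matrix NormedSpace

variable {ι α : Type*} [Fintype ι] [DecidableEq ι] [Fintype α]

/-- The matrix Laplace transform method for a sum of independent random symmetric matrices. -/
theorem sum_prod_mul_trace_exp_le {n : ℕ} (μ : Fin n → α → ℝ) (hμ : ∀ k a, 0 ≤ μ k a)
    (X : Fin n → α → Matrix ι ι ℝ) (hX : ∀ k a, (X k a).IsSymm) {b : ℝ} (hb : 0 ≤ b)
    (h : ∀ k x, ∑ a, μ k a * (x ⬝ᵥ exp (X k a) *ᵥ x) ≤ b * (x ⬝ᵥ x))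
    {Z : Matrix ι ι ℝ} (hZ : Z.IsSymm) :
    ∑ c : Fin n → α, (∏ k, μ k (c k)) * (exp (Z + ∑ k, X k (c k))).trace ≤
      b ^ n * (exp Z).trace := by
  induction n with
  | zero => simp
  | succ n ih =>
    have hsum : ∀ {n : ℕ} (Y : Fin n → α → Matrix ι ι ℝ) (hY : ∀ k a, (Y k a).IsSymm)
        (c : Fin n → α), (∑ k, Y k (c k)).IsSymm := fun Y hY c => by
      rw [Matrix.IsSymm, Matrix.transpose_sum]
      exact Finset.sum_congr rfl fun k _ => hY k _
    -- With all summands but the first fixed, Golden-Thompson separates `X 0` from the rest, and its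
    -- average is then taken inside the trace.
    rw [← (Fin.consEquiv fun _ => α).sum_comp, Fintype.sum_prod_type, Finset.sum_comm]
    have hstep : ∀ c : Fin n → α,
        ∑ a, (∏ k, μ k ((Fin.consEquiv fun _ => α) (a, c) k)) *
          (exp (Z + ∑ k, X k ((Fin.consEquiv fun _ => α) (a, c) k))).trace ≤
        b * ((∏ k : Fin n, μ k.succ (c k)) *
          (exp (Z + ∑ k : Fin n, X k.succ (c k))).trace) := by
      intro c
      set Z' := Z + ∑ k : Fin n, X k.succ (c k) with hZ'
      have hZs : Z'.IsSymm := hZ.add (hsum _ (fun k => hX k.succ) c)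
      have hp : 0 ≤ ∏ k : Fin n, μ k.succ (c k) := Finset.prod_nonneg fun k _ => hμ _ _
      calc ∑ a, (∏ k, μ k ((Fin.consEquiv fun _ => α) (a, c) k)) *
            (exp (Z + ∑ k, X k ((Fin.consEquiv fun _ => α) (a, c) k))).trace
          ≤ ∑ a, (∏ k : Fin n, μ k.succ (c k)) * (μ 0 a * (exp Z' * exp (X 0 a)).trace) := by
            refine Finset.sum_le_sum fun a _ => ?_
            rw [Fin.prod_univ_succ, Fin.sum_univ_succ]
            simp only [Fin.consEquiv_apply, Fin.cons_zero, Fin.cons_succ]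
            rw [mul_comm (μ 0 a), mul_assoc]
            refine mul_le_mul_of_nonneg_left (mul_le_mul_of_nonneg_left ?_ (hμ _ _)) hp
            rw [add_left_comm, ← hZ', add_comm]
            exact trace_exp_add_le hZs (hX 0 a)
        _ = (∏ k : Fin n, μ k.succ (c k)) * (exp Z' * ∑ a, μ 0 a • exp (X 0 a)).trace := by
            rw [← Finset.mul_sum, Matrix.mul_sum, Matrix.trace_sum]
            simp
        _ ≤ (∏ k : Fin n, μ k.succ (c k)) * (b * (exp Z').trace) := by
            refine mul_le_mul_of_nonneg_left (trace_exp_mul_le hZs fun x => ?_) hp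
            rw [Matrix.sum_mulVec, dotProduct_sum]
            simpa [Matrix.smul_mulVec] using h 0 x
        _ = _ := by ring
    refine (Finset.sum_le_sum fun c _ => hstep c).trans ?_
    rw [← Finset.mul_sum, pow_succ', mul_assoc]
    exact mul_le_mul_of_nonneg_left (ih (fun k => μ k.succ) (fun k => hμ k.succ)
      (fun k => X k.succ) (fun k => hX k.succ) (fun k => h k.succ)) hb

end MatrixLaplace

end BSBM

noncomputable section

namespace BSBM

/-! ### Exponentially weighted moments of a centred Bernoulli variable -/

section Weights

/-- The probability mass function of the Bernoulli distribution with parameter `q`. -/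
def bernoulliWeight (q : ℝ) (b : Bool) : ℝ := if b then q else 1 - q

/-- The centred indicator `1_b - q`. -/
def centered (q : ℝ) (b : Bool) : ℝ := (if b then 1 else 0) - q

variable {q p θ : ℝ}

theorem bernoulliWeight_nonneg (h0 : 0 ≤ q) (h1 : q ≤ 1) (b : Bool) : 0 ≤ bernoulliWeight q b := by
  cases b <;> simp [bernoulliWeight, h0, h1]

theorem sum_bernoulliWeight (q : ℝ) : ∑ b, bernoulliWeight q b = 1 := by
  simp [bernoulliWeight]

theorem sum_bernoulliWeight_mul_centered (q : ℝ) :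
    ∑ b, bernoulliWeight q b * centered q b = 0 := by
  simp [bernoulliWeight, centered]
  ring

theorem abs_centered_le_one (h0 : 0 ≤ q) (h1 : q ≤ 1) (b : Bool) : |centered q b| ≤ 1 := by
  cases b <;> simp [centered, abs_le] <;> constructor <;> linarith

theorem exp_le_one_add_two_mul {y : ℝ} (h0 : 0 ≤ y) (h1 : y ≤ 1) : Real.exp y ≤ 1 + 2 * y := by
  have h := Real.norm_exp_sub_one_sub_id_le (x := y) (by rwa [Real.norm_of_nonneg h0])
  rw [Real.norm_eq_abs, Real.norm_eq_abs, sq_abs] at h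
  nlinarith [le_abs_self (Real.exp y - 1 - y)]

theorem one_le_sum_bernoulliWeight_mul_exp (h0 : 0 ≤ q) (h1 : q ≤ 1) (hθ : 0 ≤ θ) :
    1 ≤ ∑ b, bernoulliWeight q b * Real.exp (θ * |centered q b|) := by
  rw [← sum_bernoulliWeight q]
  refine Finset.sum_le_sum fun b _ => ?_
  exact le_mul_of_one_le_right (bernoulliWeight_nonneg h0 h1 b) (Real.one_le_exp (by positivity))

theorem centered_true (q : ℝ) : centered q true = 1 - q := by simp [centered]

theorem centered_false (q : ℝ) : centered q false = -q := by simp [centered]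

theorem sum_bernoulliWeight_mul_exp_le (h0 : 0 ≤ q) (h1 : q ≤ 1) (hq : q ≤ 2 * p) (hθ : 0 ≤ θ)
    (hθ1 : θ ≤ 1) :
    ∑ b, bernoulliWeight q b * Real.exp (θ * |centered q b|) ≤ 1 + 8 * p * θ := by
  have e1 := exp_le_one_add_two_mul (y := θ * (1 - q)) (by nlinarith) (by nlinarith)
  have e2 := exp_le_one_add_two_mul (y := θ * q) (by nlinarith) (by nlinarith)
  simp only [Fintype.sum_bool, centered_true, centered_false, abs_neg, abs_of_nonneg h0,
    abs_of_nonneg (sub_nonneg.2 h1), bernoulliWeight, if_true, Bool.false_eq_true, if_false]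
  have e3 := mul_le_mul_of_nonneg_left e1 h0
  have e4 := mul_le_mul_of_nonneg_left e2 (sub_nonneg.2 h1)
  have e5 : θ * (q * (1 - q)) ≤ θ * (2 * p) := by
    refine mul_le_mul_of_nonneg_left ?_ hθ
    nlinarith
  nlinarith

theorem sum_bernoulliWeight_mul_sq_mul_exp_le (h0 : 0 ≤ q) (h1 : q ≤ 1) (hq : q ≤ 2 * p)
    (hθ : 0 ≤ θ) (hθ1 : θ ≤ 1) :
    ∑ b, bernoulliWeight q b * (centered q b ^ 2 * Real.exp (θ * |centered q b|)) ≤ 6 * p := by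
  have e1 := exp_le_one_add_two_mul (y := θ * (1 - q)) (by nlinarith) (by nlinarith)
  have e2 := exp_le_one_add_two_mul (y := θ * q) (by nlinarith) (by nlinarith)
  have e1' : Real.exp (θ * (1 - q)) ≤ 3 := by nlinarith
  have e2' : Real.exp (θ * q) ≤ 3 := by nlinarith
  simp only [Fintype.sum_bool, centered_true, centered_false, abs_neg, abs_of_nonneg h0,
    abs_of_nonneg (sub_nonneg.2 h1), bernoulliWeight, if_true, Bool.false_eq_true, if_false]
  have h1' := sub_nonneg.2 h1
  have e3 : q * ((1 - q) ^ 2 * Real.exp (θ * (1 - q))) ≤ q * ((1 - q) ^ 2 * 3) := by gcongr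
  have e4 : (1 - q) * ((-q) ^ 2 * Real.exp (θ * q)) ≤ (1 - q) * ((-q) ^ 2 * 3) := by gcongr
  nlinarith [mul_nonneg h0 h1', mul_nonneg h0 h0]

/-- Without the weight the mean is zero; the weight leaves q(1-q) times a difference of two
exponentials, hence the extra factor θ. -/
theorem abs_sum_bernoulliWeight_mul_centered_mul_exp_le (h0 : 0 ≤ q) (h1 : q ≤ 1)
    (hq : q ≤ 2 * p) (hθ : 0 ≤ θ) (hθ1 : θ ≤ 1) :
    |∑ b, bernoulliWeight q b * (centered q b * Real.exp (θ * |centered q b|))| ≤ 4 * p * θ := by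
  have e1 := exp_le_one_add_two_mul (y := θ * (1 - q)) (by nlinarith) (by nlinarith)
  have e2 := exp_le_one_add_two_mul (y := θ * q) (by nlinarith) (by nlinarith)
  have e1' : 1 ≤ Real.exp (θ * (1 - q)) := Real.one_le_exp (by nlinarith)
  have e2' : 1 ≤ Real.exp (θ * q) := Real.one_le_exp (by nlinarith)
  simp only [Fintype.sum_bool, centered_true, centered_false, abs_neg, abs_of_nonneg h0,
    abs_of_nonneg (sub_nonneg.2 h1), bernoulliWeight, if_true, Bool.false_eq_true, if_false]
  have e : q * ((1 - q) * Real.exp (θ * (1 - q))) + (1 - q) * (-q * Real.exp (θ * q)) =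
      q * (1 - q) * (Real.exp (θ * (1 - q)) - Real.exp (θ * q)) := by ring
  have h1' := sub_nonneg.2 h1
  have h3 : |Real.exp (θ * (1 - q)) - Real.exp (θ * q)| ≤ 2 * θ := by
    rw [abs_le]; constructor <;> nlinarith
  rw [e, abs_mul, abs_of_nonneg (mul_nonneg h0 h1')]
  calc q * (1 - q) * |Real.exp (θ * (1 - q)) - Real.exp (θ * q)| ≤ (2 * p) * (2 * θ) := by
        refine mul_le_mul (by nlinarith) h3 (abs_nonneg _) (by linarith)
    _ = 4 * p * θ := by ring

theorem sum_bernoulliWeight_mul_exp_centered_le (h0 : 0 ≤ q) (h1 : q ≤ 1) (hq : q ≤ 2 * p)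
    {s : ℝ} (hs : |s| ≤ 1) :
    ∑ b, bernoulliWeight q b * Real.exp (s * centered q b) ≤ 1 + 6 * p * s ^ 2 := by
  have h := sum_bernoulliWeight_mul_sq_mul_exp_le h0 h1 hq (abs_nonneg s) hs
  calc ∑ b, bernoulliWeight q b * Real.exp (s * centered q b)
      ≤ ∑ b, (bernoulliWeight q b + s * (bernoulliWeight q b * centered q b) +
          s ^ 2 * (bernoulliWeight q b * (centered q b ^ 2 * Real.exp (|s| * |centered q b|)))) := by
        refine Finset.sum_le_sum fun b _ => ?_
        have e := exp_le_one_add_add_sq_mul_exp_abs (s * centered q b)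
        rw [abs_mul] at e
        have := mul_le_mul_of_nonneg_left e (bernoulliWeight_nonneg h0 h1 b)
        nlinarith
    _ ≤ 1 + 6 * p * s ^ 2 := by
        rw [Finset.sum_add_distrib, Finset.sum_add_distrib, ← Finset.mul_sum, ← Finset.mul_sum,
          sum_bernoulliWeight, sum_bernoulliWeight_mul_centered]
        nlinarith [sq_nonneg s]

end Weights

/-! ### Exponential moments of one hollowed rank-one matrix -/

section Column

open Matrix

variable {ι : Type*}

/-- The rank-one matrix `w wᵀ` with its diagonal set to zero. -/
def hollowOuter [DecidableEq ι] (w : ι → ℝ) : Matrix ι ι ℝ :=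
  Matrix.of fun i j => if i = j then 0 else w i * w j

theorem hollowOuter_isSymm [DecidableEq ι] (w : ι → ℝ) : (hollowOuter w).IsSymm := by
  ext i j
  simp [hollowOuter, eq_comm, mul_comm]

variable [Fintype ι]

/-- The law of a column with independent Bernoulli entries. -/
def columnWeight (q : ι → ℝ) (a : ι → Bool) : ℝ := ∏ i, bernoulliWeight (q i) (a i)

/-- The centred column. -/
def centeredColumn (q : ι → ℝ) (a : ι → Bool) (i : ι) : ℝ := centered (q i) (a i)

theorem columnWeight_nonneg {q : ι → ℝ} (h0 : ∀ i, 0 ≤ q i) (h1 : ∀ i, q i ≤ 1) (a : ι → Bool) :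
    0 ≤ columnWeight q a :=
  Finset.prod_nonneg fun i _ => bernoulliWeight_nonneg (h0 i) (h1 i) _

variable [DecidableEq ι]

theorem sum_columnWeight_mul_prod (q : ι → ℝ) (F : ι → Bool → ℝ) :
    ∑ a, columnWeight q a * ∏ i, F i (a i) = ∏ i, ∑ b, bernoulliWeight (q i) b * F i b := by
  rw [Finset.prod_univ_sum, Fintype.piFinset_univ]
  simp [columnWeight, Finset.prod_mul_distrib]

theorem sum_columnWeight (q : ι → ℝ) : ∑ a, columnWeight q a = 1 := by
  simpa only [mul_one, Finset.prod_const_one, sum_bernoulliWeight] using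
    sum_columnWeight_mul_prod q fun _ _ => 1

theorem sum_columnWeight_mul_apply (q : ι → ℝ) (i : ι) (f : Bool → ℝ) :
    ∑ a, columnWeight q a * f (a i) = ∑ b, bernoulliWeight (q i) b * f b := by
  have h := sum_columnWeight_mul_prod q fun r b => if r = i then f b else 1
  simp only [Finset.prod_ite_eq', Finset.mem_univ, if_true] at h
  rw [h, Finset.prod_eq_single i]
  · simp
  · intro r _ hr
    simp only [if_neg hr, mul_one]
    exact sum_bernoulliWeight _
  · simp

theorem sum_columnWeight_mul_centered_mul_centered (q : ι → ℝ) {i j : ι} (hij : i ≠ j) :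
    ∑ a, columnWeight q a * (centeredColumn q a i * centeredColumn q a j) = 0 := by
  have h := sum_columnWeight_mul_prod q fun r b =>
    (if r = i then centered (q r) b else 1) * (if r = j then centered (q r) b else 1)
  simp only [Finset.prod_mul_distrib, Finset.prod_ite_eq', Finset.mem_univ, if_true] at h
  simp only [centeredColumn]
  rw [h]
  refine Finset.prod_eq_zero (Finset.mem_univ i) ?_
  simp only [if_true, if_neg hij, mul_one]
  exact sum_bernoulliWeight_mul_centered _

theorem hollowOuter_mulVec (w x : ι → ℝ) (i : ι) :
    (hollowOuter w *ᵥ x) i = w i * ∑ j ∈ Finset.univ.erase i, w j * x j := by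
  rw [← Finset.filter_ne, Finset.sum_filter, Finset.mul_sum, Matrix.mulVec, dotProduct]
  refine Finset.sum_congr rfl fun j _ => ?_
  by_cases h : i = j <;> simp [hollowOuter, h, mul_assoc]

theorem dotProduct_hollowOuter_mulVec (w x : ι → ℝ) :
    x ⬝ᵥ hollowOuter w *ᵥ x = (∑ i, w i * x i) ^ 2 - ∑ i, (w i) ^ 2 * (x i) ^ 2 := by
  have h : ∀ i, ∑ j ∈ Finset.univ.erase i, w j * x j = ∑ j, w j * x j - w i * x i := fun i => by
    rw [← Finset.sum_erase_add _ _ (Finset.mem_univ i)]; ring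
  simp only [dotProduct, hollowOuter_mulVec, h]
  rw [pow_two, Finset.sum_mul, ← Finset.sum_sub_distrib]
  exact Finset.sum_congr rfl fun i _ => by ring

/-- Cauchy-Schwarz with w² ≤ |w|. The ℓ₁ norm is used because its exponential is a product over the
rows. -/
theorem abs_dotProduct_hollowOuter_mulVec_le {w : ι → ℝ} (hw : ∀ i, |w i| ≤ 1) (x : ι → ℝ) :
    |x ⬝ᵥ hollowOuter w *ᵥ x| ≤ (∑ i, |w i|) * (x ⬝ᵥ x) := by
  have hsq : ∀ i, w i ^ 2 ≤ |w i| := fun i => by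
    rw [← sq_abs]; nlinarith [hw i, abs_nonneg (w i)]
  have hx : x ⬝ᵥ x = ∑ i, x i ^ 2 := by simp [dotProduct, pow_two]
  have hs : ∑ i, w i ^ 2 ≤ ∑ i, |w i| := Finset.sum_le_sum fun i _ => hsq i
  have hx0 : 0 ≤ ∑ i, x i ^ 2 := Finset.sum_nonneg fun i _ => sq_nonneg _
  have h1 : (∑ i, w i * x i) ^ 2 ≤ (∑ i, |w i|) * ∑ i, x i ^ 2 :=
    (Finset.sum_mul_sq_le_sq_mul_sq _ _ _).trans (by gcongr)
  have h2 : ∑ i, (w i) ^ 2 * (x i) ^ 2 ≤ (∑ i, |w i|) * ∑ i, x i ^ 2 := by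
    rw [Finset.mul_sum]
    refine Finset.sum_le_sum fun i _ => mul_le_mul_of_nonneg_right ?_ (sq_nonneg _)
    exact (hsq i).trans (Finset.single_le_sum (f := fun i => |w i|) (fun j _ => abs_nonneg _)
      (Finset.mem_univ i))
  have h3 : 0 ≤ ∑ i, (w i) ^ 2 * (x i) ^ 2 := Finset.sum_nonneg fun i _ => by positivity
  rw [dotProduct_hollowOuter_mulVec, hx, abs_le]
  constructor <;> nlinarith [sq_nonneg (∑ i, w i * x i)]

variable {q : ι → ℝ} {p θ : ℝ}

/-- By independence the expectation is a product over rows. The ordinary rows contribute at most 3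
in total, row i contributes 6p, and rows j ≠ l contribute a nearly vanishing weighted mean 4pθ each.
-/
theorem abs_sum_columnWeight_mul_le (h0 : ∀ i, 0 ≤ q i) (h1 : ∀ i, q i ≤ 1)
    (hq : ∀ i, q i ≤ 2 * p) (hp : 0 ≤ p) (hθ : 0 ≤ θ) (hθ1 : θ * (1 + 8 * Fintype.card ι * p) ≤ 1)
    {i j l : ι} (hj : j ≠ i) (hl : l ≠ i) :
    |∑ a, columnWeight q a * (centeredColumn q a i ^ 2 * (centeredColumn q a j *
      centeredColumn q a l) * Real.exp (θ * ∑ r, |centeredColumn q a r|))| ≤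
      18 * p * (if j = l then 6 * p else (4 * p * θ) ^ 2) := by
  have hnp : 0 ≤ θ * (8 * Fintype.card ι * p) := by positivity
  have hθ1' : θ ≤ 1 := by nlinarith
  have h := sum_columnWeight_mul_prod q fun r b =>
    (if r = i then centered (q r) b ^ 2 else 1) * ((if r = j then centered (q r) b else 1) *
      (if r = l then centered (q r) b else 1)) * Real.exp (θ * |centered (q r) b|)
  simp only [Finset.prod_mul_distrib, Finset.prod_ite_eq', Finset.mem_univ, if_true,
    ← Real.exp_sum, ← Finset.mul_sum] at h
  simp only [centeredColumn]
  rw [h, Finset.abs_prod]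
  set φ : ι → ℝ := fun r => ∑ b, bernoulliWeight (q r) b * Real.exp (θ * |centered (q r) b|)
  have hφ1 : ∀ r, 1 ≤ φ r := fun r => one_le_sum_bernoulliWeight_mul_exp (h0 r) (h1 r) hθ
  have hφ : ∏ r, φ r ≤ 3 := by
    calc ∏ r, φ r ≤ ∏ _r : ι, (1 + 8 * p * θ) := by
          refine Finset.prod_le_prod (fun r _ => zero_le_one.trans (hφ1 r)) fun r _ => ?_
          exact sum_bernoulliWeight_mul_exp_le (h0 r) (h1 r) (hq r) hθ hθ1'
      _ ≤ Real.exp (8 * p * θ) ^ Fintype.card ι := by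
          rw [Finset.prod_const, Finset.card_univ]
          refine pow_le_pow_left₀ (by positivity) ?_ _
          linarith [Real.add_one_le_exp (8 * p * θ)]
      _ = Real.exp (θ * (8 * Fintype.card ι * p)) := by rw [← Real.exp_nat_mul]; ring_nf
      _ ≤ 1 + 2 * (θ * (8 * Fintype.card ι * p)) :=
          exp_le_one_add_two_mul hnp (by nlinarith)
      _ ≤ 3 := by nlinarith
  have hψ := fun r => sum_bernoulliWeight_mul_sq_mul_exp_le (h0 r) (h1 r) (hq r) hθ hθ1'
  have hψ0 : ∀ r, 0 ≤ ∑ b, bernoulliWeight (q r) b *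
      (centered (q r) b ^ 2 * Real.exp (θ * |centered (q r) b|)) := fun r =>
    Finset.sum_nonneg fun b _ => mul_nonneg (bernoulliWeight_nonneg (h0 r) (h1 r) b) (by positivity)
  have hξ := fun r => abs_sum_bernoulliWeight_mul_centered_mul_exp_le (h0 r) (h1 r) (hq r) hθ hθ1'
  -- As φ r ≥ 1, this factor may be included for the exceptional rows too, and the full product of
  -- the φ r splits off.
  have hbound : ∀ r, |∑ b, bernoulliWeight (q r) b *
      ((if r = i then centered (q r) b ^ 2 else 1) * ((if r = j then centered (q r) b else 1) *
      (if r = l then centered (q r) b else 1)) * Real.exp (θ * |centered (q r) b|))| ≤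
      φ r * ((if r = i then 6 * p else 1) * (if j = l then (if r = j then 6 * p else 1) else
        (if r = j then 4 * p * θ else 1) * (if r = l then 4 * p * θ else 1))) := by
    intro r
    have hle : ∀ {y z : ℝ}, 0 ≤ z → y ≤ z → y ≤ φ r * z := fun hz hyz =>
      hyz.trans (le_mul_of_one_le_left hz (hφ1 r))
    by_cases hri : r = i
    · subst hri
      simp only [if_true, if_neg hj.symm, if_neg hl.symm, mul_one, ite_self]
      refine hle (by positivity) ?_
      rw [abs_of_nonneg (hψ0 r)]
      exact hψ r
    · by_cases hjl : j = l
      · subst hjl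
        simp only [if_neg hri, one_mul, if_true]
        by_cases hrj : r = j
        · subst hrj
          simp only [if_true, ← pow_two]
          refine hle (by positivity) ?_
          rw [abs_of_nonneg (hψ0 r)]
          exact hψ r
        · simp only [if_neg hrj, one_mul, mul_one]
          exact (abs_of_nonneg (zero_le_one.trans (hφ1 r))).le
      · simp only [if_neg hri, one_mul, if_neg hjl]
        by_cases hrj : r = j
        · subst hrj
          simp only [if_true, if_neg hjl, mul_one]
          exact hle (by positivity) (hξ r)
        · by_cases hrl : r = l
          · subst hrl
            simp only [if_true, if_neg hrj, one_mul]
            exact hle (by positivity) (hξ r)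
          · simp only [if_neg hrj, if_neg hrl, one_mul, mul_one]
            exact (abs_of_nonneg (zero_le_one.trans (hφ1 r))).le
  refine (Finset.prod_le_prod (fun r _ => abs_nonneg _) fun r _ => hbound r).trans ?_
  rw [Finset.prod_mul_distrib, Finset.prod_mul_distrib]
  have hlast : ∏ r, (if j = l then (if r = j then 6 * p else 1) else
      (if r = j then 4 * p * θ else 1) * (if r = l then 4 * p * θ else 1)) =
      if j = l then 6 * p else (4 * p * θ) ^ 2 := by
    by_cases hjl : j = l
    · simp [hjl]
    · simp only [if_neg hjl, Finset.prod_mul_distrib, Finset.prod_ite_eq', Finset.mem_univ,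
        if_true, pow_two]
  rw [hlast]
  simp only [Finset.prod_ite_eq', Finset.mem_univ, if_true]
  have hc : 0 ≤ 6 * p * (if j = l then 6 * p else (4 * p * θ) ^ 2) := by
    split_ifs <;> positivity
  calc (∏ r, φ r) * (6 * p * (if j = l then 6 * p else (4 * p * θ) ^ 2))
      ≤ 3 * (6 * p * (if j = l then 6 * p else (4 * p * θ) ^ 2)) := by gcongr
    _ = _ := by ring

/-- Exponentially weighted second moment of an entry of `H(w wᵀ) x` for a random column `w`. -/
theorem sum_columnWeight_mul_sq_mul_exp_le (h0 : ∀ i, 0 ≤ q i) (h1 : ∀ i, q i ≤ 1)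
    (hq : ∀ i, q i ≤ 2 * p) (hp : 0 ≤ p) (hθ : 0 ≤ θ) (hθ1 : θ * (1 + 8 * Fintype.card ι * p) ≤ 1)
    (x : ι → ℝ) (i : ι) :
    ∑ a, columnWeight q a * ((hollowOuter (centeredColumn q a) *ᵥ x) i ^ 2 *
      Real.exp (θ * ∑ r, |centeredColumn q a r|)) ≤ 144 * p ^ 2 * (x ⬝ᵥ x) := by
  have hnp : 0 ≤ θ * (8 * Fintype.card ι * p) := by positivity
  have hθ1' : θ ≤ 1 := by nlinarith
  have hx : x ⬝ᵥ x = ∑ i, x i ^ 2 := by simp [dotProduct, pow_two]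
  have hexpand : ∀ a, columnWeight q a * ((hollowOuter (centeredColumn q a) *ᵥ x) i ^ 2 *
      Real.exp (θ * ∑ r, |centeredColumn q a r|)) =
      ∑ j ∈ Finset.univ.erase i, ∑ l ∈ Finset.univ.erase i, x j * x l * (columnWeight q a *
        (centeredColumn q a i ^ 2 * (centeredColumn q a j * centeredColumn q a l) *
          Real.exp (θ * ∑ r, |centeredColumn q a r|))) := by
    intro a
    rw [hollowOuter_mulVec, mul_pow, pow_two (Finset.sum _ _), Finset.sum_mul_sum]
    simp only [Finset.mul_sum, Finset.sum_mul]
    exact Finset.sum_congr rfl fun j _ => Finset.sum_congr rfl fun l _ => by ring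
  simp only [hexpand]
  rw [Finset.sum_comm]
  have hin : ∀ j ∈ Finset.univ.erase i, ∀ l ∈ Finset.univ.erase i,
      ∑ a, x j * x l * (columnWeight q a *
        (centeredColumn q a i ^ 2 * (centeredColumn q a j * centeredColumn q a l) *
          Real.exp (θ * ∑ r, |centeredColumn q a r|))) ≤
      18 * p * ((if j = l then 6 * p * x j ^ 2 else 0) + (4 * p * θ) ^ 2 * (|x j| * |x l|)) := by
    intro j hj l hl
    rw [← Finset.mul_sum]
    refine (le_abs_self _).trans ?_
    rw [abs_mul, abs_mul]
    refine (mul_le_mul_of_nonneg_left (abs_sum_columnWeight_mul_le h0 h1 hq hp hθ hθ1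
      (Finset.ne_of_mem_erase hj) (Finset.ne_of_mem_erase hl)) (by positivity)).trans ?_
    by_cases hjl : j = l
    · subst hjl
      simp only [if_true]
      have : 0 ≤ 18 * p * ((4 * p * θ) ^ 2 * (|x j| * |x j|)) := by positivity
      have e : |x j| * |x j| = x j ^ 2 := by rw [← pow_two, sq_abs]
      rw [e] at this ⊢
      nlinarith
    · simp only [if_neg hjl]
      exact le_of_eq (by ring)
  have hcs : (∑ j, |x j|) ^ 2 ≤ Fintype.card ι * ∑ j, x j ^ 2 := by
    have := sq_sum_le_card_mul_sum_sq (s := Finset.univ) (f := fun j => |x j|)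
    simpa using this
  have hx0 : 0 ≤ ∑ i, x i ^ 2 := Finset.sum_nonneg fun i _ => sq_nonneg _
  calc ∑ j ∈ Finset.univ.erase i, ∑ a, ∑ l ∈ Finset.univ.erase i, x j * x l * (columnWeight q a *
        (centeredColumn q a i ^ 2 * (centeredColumn q a j * centeredColumn q a l) *
          Real.exp (θ * ∑ r, |centeredColumn q a r|)))
      ≤ ∑ j ∈ Finset.univ.erase i, ∑ l ∈ Finset.univ.erase i,
        18 * p * ((if j = l then 6 * p * x j ^ 2 else 0) + (4 * p * θ) ^ 2 * (|x j| * |x l|)) := by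
        refine Finset.sum_le_sum fun j hj => ?_
        rw [Finset.sum_comm]
        exact Finset.sum_le_sum fun l hl => hin j hj l hl
    _ ≤ ∑ j, ∑ l,
        18 * p * ((if j = l then 6 * p * x j ^ 2 else 0) + (4 * p * θ) ^ 2 * (|x j| * |x l|)) := by
        have hnn : ∀ j l, 0 ≤ 18 * p * ((if j = l then 6 * p * x j ^ 2 else 0) +
            (4 * p * θ) ^ 2 * (|x j| * |x l|)) := fun j l => by split_ifs <;> positivity
        refine (Finset.sum_le_sum fun j _ => Finset.sum_le_sum_of_subset_of_nonneg
          (Finset.subset_univ _) fun l _ _ => hnn j l).trans ?_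
        exact Finset.sum_le_sum_of_subset_of_nonneg (Finset.subset_univ _)
          fun j _ _ => Finset.sum_nonneg fun l _ => hnn j l
    _ = 18 * p * (6 * p * ∑ j, x j ^ 2 + (4 * p * θ) ^ 2 * (∑ j, |x j|) ^ 2) := by
        simp only [← Finset.mul_sum, Finset.sum_add_distrib, Finset.sum_ite_eq, Finset.mem_univ,
          if_true, pow_two (∑ j, |x j|), Finset.sum_mul_sum]
    _ ≤ 18 * p * (6 * p * ∑ j, x j ^ 2 + (4 * p * θ) ^ 2 * (Fintype.card ι * ∑ j, x j ^ 2)) := by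
        gcongr
    _ = 18 * p * ∑ j, x j ^ 2 * (6 * p + 2 * p * (θ * (θ * (8 * Fintype.card ι * p)))) := by
        rw [← Finset.sum_mul]; ring
    -- The hypothesis on θ gives both θ ≤ 1 and 8npθ ≤ 1; thus all off-diagonal pairs together cost
    -- only 2p, and 18(6+2) = 144.
    _ ≤ 18 * p * ∑ j, x j ^ 2 * (6 * p + 2 * p * 1) := by
        gcongr
        nlinarith
    _ = 144 * p ^ 2 * (x ⬝ᵥ x) := by rw [hx, ← Finset.sum_mul]; ring

/-- Hollowing is essential here: only products of distinct, hence uncorrelated, entries remain. -/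
theorem sum_columnWeight_mul_hollowOuter_mulVec (q : ι → ℝ) (x : ι → ℝ) (i : ι) :
    ∑ a, columnWeight q a * (hollowOuter (centeredColumn q a) *ᵥ x) i = 0 := by
  simp only [hollowOuter_mulVec, Finset.mul_sum]
  rw [Finset.sum_comm]
  refine Finset.sum_eq_zero fun j hj => ?_
  have h := sum_columnWeight_mul_centered_mul_centered q (Finset.ne_of_mem_erase hj).symm
  calc _ = (∑ a, columnWeight q a * (centeredColumn q a i * centeredColumn q a j)) * x j := by
        rw [Finset.sum_mul]; exact Finset.sum_congr rfl fun a _ => by ring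
    _ = 0 := by rw [h, zero_mul]

/-- Exponential moment of the quadratic form of `H(w wᵀ)`. -/
theorem sum_columnWeight_mul_dotProduct_exp_le (h0 : ∀ i, 0 ≤ q i) (h1 : ∀ i, q i ≤ 1)
    (hq : ∀ i, q i ≤ 2 * p) (hp : 0 ≤ p) {s : ℝ}
    (hs : |s| * (1 + 8 * Fintype.card ι * p) ≤ 1) (x : ι → ℝ) :
    ∑ a, columnWeight q a *
      (x ⬝ᵥ NormedSpace.exp (s • hollowOuter (centeredColumn q a)) *ᵥ x) ≤
      (1 + 144 * Fintype.card ι * p ^ 2 * s ^ 2) * (x ⬝ᵥ x) := by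
  have hpt : ∀ a, x ⬝ᵥ NormedSpace.exp (s • hollowOuter (centeredColumn q a)) *ᵥ x ≤
      x ⬝ᵥ x + s * ∑ i, x i * (hollowOuter (centeredColumn q a) *ᵥ x) i +
      s ^ 2 * ∑ i, (hollowOuter (centeredColumn q a) *ᵥ x) i ^ 2 *
        Real.exp (|s| * ∑ r, |centeredColumn q a r|) := by
    intro a
    -- The bound on the quadratic form depends on the sample, so the second-order remainder carries
    -- the random weight treated above.
    have hb := dotProduct_exp_mulVec_le ((hollowOuter_isSymm (centeredColumn q a)).smul s)
      (b := |s| * ∑ r, |centeredColumn q a r|) (fun y => by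
        rw [Matrix.smul_mulVec, dotProduct_smul, smul_eq_mul, abs_mul, mul_assoc]
        exact mul_le_mul_of_nonneg_left (abs_dotProduct_hollowOuter_mulVec_le
          (fun i => abs_centered_le_one (h0 i) (h1 i) _) y) (abs_nonneg s)) x
    rw [Matrix.smul_mulVec, dotProduct_smul, smul_dotProduct, dotProduct_smul] at hb
    refine hb.trans (le_of_eq ?_)
    rw [← Finset.sum_mul]
    simp only [smul_eq_mul, dotProduct, ← pow_two]
    ring
  calc _ ≤ ∑ a, columnWeight q a * (x ⬝ᵥ x +
        s * ∑ i, x i * (hollowOuter (centeredColumn q a) *ᵥ x) i +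
        s ^ 2 * ∑ i, (hollowOuter (centeredColumn q a) *ᵥ x) i ^ 2 *
          Real.exp (|s| * ∑ r, |centeredColumn q a r|)) :=
        Finset.sum_le_sum fun a _ => mul_le_mul_of_nonneg_left (hpt a)
          (columnWeight_nonneg h0 h1 a)
    _ = (∑ a, columnWeight q a) * (x ⬝ᵥ x) +
        s * ∑ i, x i * ∑ a, columnWeight q a * (hollowOuter (centeredColumn q a) *ᵥ x) i +
        s ^ 2 * ∑ i, ∑ a, columnWeight q a * ((hollowOuter (centeredColumn q a) *ᵥ x) i ^ 2 *
          Real.exp (|s| * ∑ r, |centeredColumn q a r|)) := by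
        simp only [Finset.mul_sum, mul_add, Finset.sum_add_distrib, Finset.sum_mul]
        refine congrArg₂ (· + ·) (congrArg₂ (· + ·) rfl ?_) ?_
        · rw [Finset.sum_comm]
          exact Finset.sum_congr rfl fun j _ => Finset.sum_congr rfl fun l _ => by ring
        · rw [Finset.sum_comm]
          exact Finset.sum_congr rfl fun j _ => Finset.sum_congr rfl fun l _ => by ring
    _ ≤ 1 * (x ⬝ᵥ x) + s * ∑ i, x i * 0 + s ^ 2 * ∑ _i : ι, 144 * p ^ 2 * (x ⬝ᵥ x) := by
        rw [sum_columnWeight]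
        simp only [sum_columnWeight_mul_hollowOuter_mulVec]
        gcongr with i
        exact sum_columnWeight_mul_sq_mul_exp_le h0 h1 hq hp (abs_nonneg s) hs x i
    _ = _ := by
        simp only [mul_zero, Finset.sum_const_zero, Finset.sum_const, Finset.card_univ,
          nsmul_eq_mul]
        ring

/-- Exponential moment of an entry of `H(w wᵀ) x`. -/
theorem sum_columnWeight_mul_exp_hollowOuter_mulVec_le (h0 : ∀ i, 0 ≤ q i) (h1 : ∀ i, q i ≤ 1)
    (hq : ∀ i, q i ≤ 2 * p) (hp : 0 ≤ p) {s : ℝ}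
    (hs : |s| * (1 + 8 * Fintype.card ι * p) ≤ 1) {x : ι → ℝ} (hx : ∀ i, |x i| ≤ 1) (i : ι) :
    ∑ a, columnWeight q a * Real.exp (s * (hollowOuter (centeredColumn q a) *ᵥ x) i) ≤
      1 + 144 * Fintype.card ι * p ^ 2 * s ^ 2 := by
  have hab : ∀ a, |(hollowOuter (centeredColumn q a) *ᵥ x) i| ≤ ∑ r, |centeredColumn q a r| := by
    intro a
    rw [hollowOuter_mulVec, abs_mul]
    refine (mul_le_of_le_one_left (abs_nonneg _) (abs_centered_le_one (h0 i) (h1 i) _)).trans ?_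
    refine (Finset.abs_sum_le_sum_abs _ _).trans ((Finset.sum_le_sum_of_subset_of_nonneg
      (Finset.subset_univ _) fun _ _ _ => abs_nonneg _).trans ?_)
    refine Finset.sum_le_sum fun r _ => ?_
    rw [abs_mul]
    exact mul_le_of_le_one_right (abs_nonneg _) (hx r)
  have hpt : ∀ a, Real.exp (s * (hollowOuter (centeredColumn q a) *ᵥ x) i) ≤
      1 + s * (hollowOuter (centeredColumn q a) *ᵥ x) i +
      s ^ 2 * ((hollowOuter (centeredColumn q a) *ᵥ x) i ^ 2 *
        Real.exp (|s| * ∑ r, |centeredColumn q a r|)) := by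
    intro a
    refine (exp_le_one_add_add_sq_mul_exp_abs _).trans ?_
    rw [mul_pow, abs_mul, mul_assoc]
    gcongr
    exact hab a
  have hxx : x ⬝ᵥ x ≤ Fintype.card ι := by
    rw [dotProduct, ← nsmul_one, ← Finset.card_univ]
    refine Finset.sum_le_card_nsmul _ _ _ fun r _ => ?_
    rw [← abs_mul_abs_self]
    nlinarith [hx r, abs_nonneg (x r)]
  calc _ ≤ ∑ a, columnWeight q a * (1 + s * (hollowOuter (centeredColumn q a) *ᵥ x) i +
        s ^ 2 * ((hollowOuter (centeredColumn q a) *ᵥ x) i ^ 2 *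
          Real.exp (|s| * ∑ r, |centeredColumn q a r|))) :=
        Finset.sum_le_sum fun a _ => mul_le_mul_of_nonneg_left (hpt a)
          (columnWeight_nonneg h0 h1 a)
    _ = ∑ a, columnWeight q a +
        s * ∑ a, columnWeight q a * (hollowOuter (centeredColumn q a) *ᵥ x) i +
        s ^ 2 * ∑ a, columnWeight q a * ((hollowOuter (centeredColumn q a) *ᵥ x) i ^ 2 *
          Real.exp (|s| * ∑ r, |centeredColumn q a r|)) := by
        simp only [Finset.mul_sum, mul_add, Finset.sum_add_distrib, mul_one]
        congr 2
        · exact Finset.sum_congr rfl fun l _ => by ring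
        · funext l; ring
    _ ≤ 1 + s * 0 + s ^ 2 * (144 * p ^ 2 * Fintype.card ι) := by
        rw [sum_columnWeight, sum_columnWeight_mul_hollowOuter_mulVec]
        gcongr
        exact (sum_columnWeight_mul_sq_mul_exp_le h0 h1 hq hp (abs_nonneg s) hs x i).trans
          (by gcongr)
    _ = _ := by ring

end Column

end BSBM

end

/-! ### The law of the data matrix as a finite sum -/

noncomputable section

namespace BSBM

open Matrix

variable {n₁ n₂ : ℕ}

/-- The mean of the entry in row `i` and column `k`, indexed by the column first. -/
def edgeProb (η₁ : Fin n₁ → ℝ) (η₂ : Fin n₂ → ℝ) (δ p : ℝ) (k : Fin n₂) (i : Fin n₁) : ℝ :=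
  if η₁ i = η₂ k then δ * p else (2 - δ) * p

/-- The noise matrix `A - 𝔼 A`. -/
def noise (η₁ : Fin n₁ → ℝ) (η₂ : Fin n₂ → ℝ) (δ p : ℝ) (A : Matrix (Fin n₁) (Fin n₂) ℝ) :
    Matrix (Fin n₁) (Fin n₂) ℝ :=
  A - Matrix.of fun i k => edgeProb η₁ η₂ δ p k i

/-- The hollowed Gram matrix of the noise. -/
def noiseGram (η₁ : Fin n₁ → ℝ) (η₂ : Fin n₂ → ℝ) (δ p : ℝ) (A : Matrix (Fin n₁) (Fin n₂) ℝ) :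
    Matrix (Fin n₁) (Fin n₁) ℝ :=
  hollow (noise η₁ η₂ δ p A * (noise η₁ η₂ δ p A)ᵀ)

/-- The `0/1` matrix with given columns. -/
def boolMatrix (c : Fin n₂ → Fin n₁ → Bool) : Matrix (Fin n₁) (Fin n₂) ℝ :=
  Matrix.of fun i k => if c k i then 1 else 0

/-- The probability mass function of the columns of `A`. -/
def jointWeight (q : Fin n₂ → Fin n₁ → ℝ) (c : Fin n₂ → Fin n₁ → Bool) : ℝ :=
  ∏ k, columnWeight (q k) (c k)

theorem sum_jointWeight_mul_prod (q : Fin n₂ → Fin n₁ → ℝ) (F : Fin n₂ → (Fin n₁ → Bool) → ℝ) :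
    ∑ c, jointWeight q c * ∏ k, F k (c k) = ∏ k, ∑ a, columnWeight (q k) a * F k a := by
  rw [Finset.prod_univ_sum, Fintype.piFinset_univ]
  simp [jointWeight, Finset.prod_mul_distrib]

theorem hollow_apply {n : ℕ} (M : Matrix (Fin n) (Fin n) ℝ) (i j : Fin n) :
    hollow M i j = if i = j then 0 else M i j := by
  by_cases h : i = j
  · subst h; simp [hollow]
  · simp [hollow, h]

theorem hollow_isSymm {n : ℕ} {M : Matrix (Fin n) (Fin n) ℝ} (hM : M.IsSymm) :
    (hollow M).IsSymm := by
  ext i j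
  rw [Matrix.transpose_apply, hollow_apply, hollow_apply, hM.apply]
  simp [eq_comm]

section Law

variable {η₁ : Fin n₁ → ℝ} {η₂ : Fin n₂ → ℝ} {δ p : ℝ}

theorem noise_boolMatrix (c : Fin n₂ → Fin n₁ → Bool) (i : Fin n₁) (k : Fin n₂) :
    noise η₁ η₂ δ p (boolMatrix c) i k = centeredColumn (edgeProb η₁ η₂ δ p k) (c k) i := by
  simp [noise, boolMatrix, centeredColumn, centered]

theorem noiseGram_boolMatrix (c : Fin n₂ → Fin n₁ → Bool) :
    noiseGram η₁ η₂ δ p (boolMatrix c) =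
      ∑ k, hollowOuter (centeredColumn (edgeProb η₁ η₂ δ p k) (c k)) := by
  ext i j
  rw [noiseGram, hollow_apply, Matrix.sum_apply]
  by_cases h : i = j
  · simp [h, hollowOuter]
  · simp [h, hollowOuter, Matrix.mul_apply, noise_boolMatrix]

theorem edgeProb_nonneg (hδ : δ ∈ Set.Ioo (0 : ℝ) 2) (hp : p ∈ Set.Ioo (0 : ℝ) (1 / 2))
    (k : Fin n₂) (i : Fin n₁) : 0 ≤ edgeProb η₁ η₂ δ p k i := by
  obtain ⟨h1, h2⟩ := hδ
  obtain ⟨h3, h4⟩ := hp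
  unfold edgeProb
  split_ifs <;> nlinarith

theorem edgeProb_le_two_mul (hδ : δ ∈ Set.Ioo (0 : ℝ) 2) (hp : p ∈ Set.Ioo (0 : ℝ) (1 / 2))
    (k : Fin n₂) (i : Fin n₁) : edgeProb η₁ η₂ δ p k i ≤ 2 * p := by
  obtain ⟨h1, h2⟩ := hδ
  obtain ⟨h3, h4⟩ := hp
  unfold edgeProb
  split_ifs <;> nlinarith

theorem edgeProb_le_one (hδ : δ ∈ Set.Ioo (0 : ℝ) 2) (hp : p ∈ Set.Ioo (0 : ℝ) (1 / 2))
    (k : Fin n₂) (i : Fin n₁) : edgeProb η₁ η₂ δ p k i ≤ 1 :=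
  (edgeProb_le_two_mul hδ hp k i).trans (by linarith [hp.2])

variable {Ω : Type*} [MeasurableSpace Ω] {P : Measure Ω}
  {A : Ω → Matrix (Fin n₁) (Fin n₂) ℝ}

theorem IsBSBM.measureReal_eq_one (h : IsBSBM P A η₁ η₂ δ p) (hδ : δ ∈ Set.Ioo (0 : ℝ) 2)
    (hp : p ∈ Set.Ioo (0 : ℝ) (1 / 2)) (i : Fin n₁) (k : Fin n₂) :
    P.real {ω | A ω i k = 1} = edgeProb η₁ η₂ δ p k i := by
  have h0 := edgeProb_nonneg (η₁ := η₁) (η₂ := η₂) hδ hp k i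
  rw [measureReal_def]
  by_cases he : η₁ i = η₂ k
  · rw [h.prob_same i k he]
    simp only [edgeProb, if_pos he] at h0 ⊢
    exact ENNReal.toReal_ofReal h0
  · rw [h.prob_diff i k he]
    simp only [edgeProb, if_neg he] at h0 ⊢
    exact ENNReal.toReal_ofReal h0

variable [IsProbabilityMeasure P]

theorem IsBSBM.measureReal_eq_bool (h : IsBSBM P A η₁ η₂ δ p) (hδ : δ ∈ Set.Ioo (0 : ℝ) 2)
    (hp : p ∈ Set.Ioo (0 : ℝ) (1 / 2)) (i : Fin n₁) (k : Fin n₂) (b : Bool) :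
    P.real {ω | A ω i k = if b then 1 else 0} =
      bernoulliWeight (edgeProb η₁ η₂ δ p k i) b := by
  have h1 := h.measureReal_eq_one hδ hp i k
  cases b with
  | true => simpa [bernoulliWeight] using h1
  | false =>
    have hm : MeasurableSet {ω | A ω i k = 1} :=
      h.measurable_entry i k (measurableSet_singleton (1 : ℝ))
    have hc : {ω | A ω i k = if false then (1 : ℝ) else 0} = {ω | A ω i k = 1}ᶜ := by
      ext ω
      rcases h.entry_eq ω i k with h' | h' <;> simp [h']
    rw [hc, probReal_compl_eq_one_sub hm, h1]
    simp [bernoulliWeight]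

theorem IsBSBM.measureReal_eq_boolMatrix (h : IsBSBM P A η₁ η₂ δ p)
    (hδ : δ ∈ Set.Ioo (0 : ℝ) 2) (hp : p ∈ Set.Ioo (0 : ℝ) (1 / 2))
    (c : Fin n₂ → Fin n₁ → Bool) :
    P.real {ω | A ω = boolMatrix c} = jointWeight (edgeProb η₁ η₂ δ p) c := by
  have hind := h.indep.measure_inter_preimage_eq_mul Finset.univ
    (sets := fun e : Fin n₁ × Fin n₂ => {if c e.2 e.1 then (1 : ℝ) else 0})
    fun e _ => measurableSet_singleton _
  have hset : {ω | A ω = boolMatrix c} = ⋂ e ∈ (Finset.univ : Finset (Fin n₁ × Fin n₂)),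
      (fun ω => A ω e.1 e.2) ⁻¹' {if c e.2 e.1 then (1 : ℝ) else 0} := by
    ext ω
    simp only [Set.mem_ofPred_eq, Set.mem_iInter, Finset.mem_univ, forall_true_left,
      Set.mem_preimage, Set.mem_singleton_iff, Prod.forall]
    refine ⟨fun hA i k => by rw [hA]; rfl, fun hA => ?_⟩
    ext i k
    exact hA i k
  rw [measureReal_def, hset, hind, ENNReal.toReal_prod, Fintype.prod_prod_type, Finset.prod_comm,
    jointWeight]
  refine Finset.prod_congr rfl fun k _ => Finset.prod_congr rfl fun i _ => ?_
  exact h.measureReal_eq_bool hδ hp i k (c k i)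

/-- Markov's inequality under the bipartite stochastic block model. -/
theorem IsBSBM.measureReal_le (h : IsBSBM P A η₁ η₂ δ p)
    (hδ : δ ∈ Set.Ioo (0 : ℝ) 2) (hp : p ∈ Set.Ioo (0 : ℝ) (1 / 2))
    (S : Set (Matrix (Fin n₁) (Fin n₂) ℝ)) (F : (Fin n₂ → Fin n₁ → Bool) → ℝ)
    (hF : ∀ c, 0 ≤ F c) {K : ℝ} (hK : 0 < K) (hS : ∀ c, boolMatrix c ∈ S → K ≤ F c) :
    P.real {ω | A ω ∈ S} ≤ K⁻¹ * ∑ c, jointWeight (edgeProb η₁ η₂ δ p) c * F c := by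
  classical
  have hw : ∀ c, 0 ≤ jointWeight (edgeProb η₁ η₂ δ p) c := fun c =>
    Finset.prod_nonneg fun k _ => columnWeight_nonneg (fun i => edgeProb_nonneg hδ hp k i)
      (fun i => edgeProb_le_one hδ hp k i) _
  -- Entries are 0 or 1, so finitely many atoms cover the event and S need not be measurable.
  have hsub : {ω | A ω ∈ S} ⊆ ⋃ c ∈ Finset.univ.filter fun c => boolMatrix c ∈ S,
      {ω | A ω = boolMatrix c} := by
    intro ω hω
    have e : A ω = boolMatrix fun k i => decide (A ω i k = 1) := by
      ext i k
      rcases h.entry_eq ω i k with h' | h' <;> simp [boolMatrix, h']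
    simp only [Set.mem_iUnion, Finset.mem_filter, Finset.mem_univ, true_and]
    exact ⟨_, e ▸ hω, e⟩
  calc P.real {ω | A ω ∈ S}
      ≤ P.real (⋃ c ∈ Finset.univ.filter fun c => boolMatrix c ∈ S, {ω | A ω = boolMatrix c}) :=
        measureReal_mono hsub (measure_ne_top P _)
    _ ≤ ∑ c ∈ Finset.univ.filter fun c => boolMatrix c ∈ S, P.real {ω | A ω = boolMatrix c} :=
        measureReal_biUnion_finset_le _ _
    _ ≤ ∑ c ∈ Finset.univ.filter fun c => boolMatrix c ∈ S,
          K⁻¹ * (jointWeight (edgeProb η₁ η₂ δ p) c * F c) := by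
        refine Finset.sum_le_sum fun c hc => ?_
        rw [h.measureReal_eq_boolMatrix hδ hp c, mul_left_comm]
        refine le_mul_of_one_le_right (hw c) ?_
        rw [← inv_mul_cancel₀ hK.ne']
        exact mul_le_mul_of_nonneg_left (hS c (Finset.mem_filter.1 hc).2) (inv_nonneg.2 hK.le)
    _ ≤ ∑ c, K⁻¹ * (jointWeight (edgeProb η₁ η₂ δ p) c * F c) :=
        Finset.sum_le_sum_of_subset_of_nonneg (Finset.subset_univ _) fun c _ _ =>
          mul_nonneg (inv_nonneg.2 hK.le) (mul_nonneg (hw c) (hF c))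
    _ = _ := by rw [Finset.mul_sum]

end Law

/-! ### Concentration of the noise -/

section Chernoff

theorem one_add_pow_le_exp {v : ℝ} (hv : 0 ≤ v) (n : ℕ) : (1 + v) ^ n ≤ Real.exp (n * v) := by
  rw [Real.exp_nat_mul]
  exact pow_le_pow_left₀ (by positivity) (by linarith [Real.add_one_le_exp v]) n

/-- With Chernoff parameter 6L/t the linear part of the exponent is -6L, and the variance condition
keeps the quadratic part below 3L. -/
theorem exp_neg_mul_exp_le {L t v : ℝ} (ht : 0 < t) (hL : 0 ≤ L) (hv : 12 * v * L ≤ t ^ 2) :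
    (Real.exp (6 * L / t * t))⁻¹ * Real.exp (v * (6 * L / t) ^ 2) ≤ Real.exp (-(3 * L)) := by
  rw [← Real.exp_neg, ← Real.exp_add, Real.exp_le_exp, div_mul_cancel₀ _ ht.ne', div_pow,
    mul_div_assoc']
  have : v * (6 * L) ^ 2 / t ^ 2 ≤ 3 * L := by
    rw [div_le_iff₀ (by positivity)]
    nlinarith
  linarith

theorem trace_exp_nonneg {ι : Type*} [Fintype ι] [DecidableEq ι] {M : Matrix ι ι ℝ}
    (hM : M.IsSymm) : 0 ≤ (NormedSpace.exp M).trace := by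
  obtain ⟨l, U, hU, hU', rfl⟩ := exists_orthogonal_diagonalization hM
  rw [exp_conj_diagonal hU, Matrix.trace_mul_comm, ← Matrix.mul_assoc, hU', one_mul,
    Matrix.trace_diagonal]
  exact Finset.sum_nonneg fun i _ => (Real.exp_pos _).le

theorem exp_le_exp_add_exp_neg {s t y : ℝ} (hs : 0 < s) (h : t < |y|) :
    Real.exp (s * t) ≤ Real.exp (s * y) + Real.exp (-s * y) := by
  rcases lt_abs.1 h with h | h
  · have : Real.exp (s * t) ≤ Real.exp (s * y) := Real.exp_le_exp.2 (by nlinarith)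
    linarith [Real.exp_pos (-s * y)]
  · have : Real.exp (s * t) ≤ Real.exp (-s * y) := Real.exp_le_exp.2 (by nlinarith)
    linarith [Real.exp_pos (s * y)]

variable {η₁ : Fin n₁ → ℝ} {η₂ : Fin n₂ → ℝ} {δ p : ℝ}
variable {Ω : Type*} [MeasurableSpace Ω] {P : Measure Ω} [IsProbabilityMeasure P]
  {A : Ω → Matrix (Fin n₁) (Fin n₂) ℝ}

theorem noiseGram_isSymm (A : Matrix (Fin n₁) (Fin n₂) ℝ) : (noiseGram η₁ η₂ δ p A).IsSymm :=
  hollow_isSymm (by rw [Matrix.IsSymm, Matrix.transpose_mul, Matrix.transpose_transpose])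

/-- Operator norm bound for the hollowed Gram matrix of the noise. -/
theorem IsBSBM.measureReal_quadForm_le (h : IsBSBM P A η₁ η₂ δ p)
    (hδ : δ ∈ Set.Ioo (0 : ℝ) 2) (hp : p ∈ Set.Ioo (0 : ℝ) (1 / 2)) {L t : ℝ} (hL : 0 < L)
    (ht : 0 < t) (hθ : 6 * L / t * (1 + 8 * n₁ * p) ≤ 1)
    (hv : 12 * (n₂ * (144 * n₁ * p ^ 2)) * L ≤ t ^ 2) :
    P.real {ω | ¬ ∀ x, |x ⬝ᵥ noiseGram η₁ η₂ δ p (A ω) *ᵥ x| ≤ t * (x ⬝ᵥ x)} ≤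
      2 * n₁ * Real.exp (-(3 * L)) := by
  set s := 6 * L / t with hs
  have hs0 : 0 < s := by positivity
  have hmgf : ∀ r : ℝ, |r| = s → ∑ c, jointWeight (edgeProb η₁ η₂ δ p) c *
      (NormedSpace.exp (r • noiseGram η₁ η₂ δ p (boolMatrix c))).trace ≤
      Real.exp (n₂ * (144 * n₁ * p ^ 2) * s ^ 2) * n₁ := by
    intro r hr
    have hr2 : r ^ 2 = s ^ 2 := by rw [← sq_abs, hr]
    have hX := sum_prod_mul_trace_exp_le
      (fun k a => columnWeight (edgeProb η₁ η₂ δ p k) a)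
      (fun k a => columnWeight_nonneg (fun i => edgeProb_nonneg hδ hp k i)
        (fun i => edgeProb_le_one hδ hp k i) a)
      (fun k a => r • hollowOuter (centeredColumn (edgeProb η₁ η₂ δ p k) a))
      (fun k a => (hollowOuter_isSymm _).smul r)
      (b := 1 + 144 * Fintype.card (Fin n₁) * p ^ 2 * r ^ 2) (by positivity)
      (fun k x => sum_columnWeight_mul_dotProduct_exp_le (fun i => edgeProb_nonneg hδ hp k i)
        (fun i => edgeProb_le_one hδ hp k i) (fun i => edgeProb_le_two_mul hδ hp k i) hp.1.le
        (by rwa [hr, Fintype.card_fin]) x) (Z := 0) (by simp [Matrix.IsSymm])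
    simp only [zero_add, NormedSpace.exp_zero, Matrix.trace_one, Fintype.card_fin, hr2] at hX
    simp only [noiseGram_boolMatrix, Finset.smul_sum, jointWeight]
    refine hX.trans (mul_le_mul_of_nonneg_right ?_ (Nat.cast_nonneg _))
    refine (one_add_pow_le_exp (by positivity) n₂).trans (le_of_eq ?_)
    ring_nf
  refine (h.measureReal_le hδ hp
    {B | ¬ ∀ x, |x ⬝ᵥ noiseGram η₁ η₂ δ p B *ᵥ x| ≤ t * (x ⬝ᵥ x)}
    (fun c => (NormedSpace.exp (s • noiseGram η₁ η₂ δ p (boolMatrix c))).trace +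
      (NormedSpace.exp ((-s) • noiseGram η₁ η₂ δ p (boolMatrix c))).trace)
    (fun c => add_nonneg (trace_exp_nonneg ((noiseGram_isSymm _).smul _))
      (trace_exp_nonneg ((noiseGram_isSymm _).smul _))) (Real.exp_pos (s * t))
    fun c hc => ?_).trans ?_
  · by_contra hlt
    push Not at hlt
    refine hc fun x => ?_
    -- Both traces are nonnegative, so each of them separately lies below exp(st); the two signs of
    -- s bound the form from both sides.
    have h1 := trace_exp_nonneg ((noiseGram_isSymm (η₁ := η₁) (η₂ := η₂) (δ := δ) (p := p)
      (boolMatrix c)).smul s)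
    have h2 := trace_exp_nonneg ((noiseGram_isSymm (η₁ := η₁) (η₂ := η₂) (δ := δ) (p := p)
      (boolMatrix c)).smul (-s))
    have h3 := dotProduct_mulVec_le_of_trace_exp_le ((noiseGram_isSymm _).smul s)
      (t := s * t) (by linarith) x
    have h4 := dotProduct_mulVec_le_of_trace_exp_le ((noiseGram_isSymm _).smul (-s))
      (t := s * t) (by linarith) x
    rw [Matrix.smul_mulVec, dotProduct_smul, smul_eq_mul] at h3 h4
    rw [abs_le]
    constructor <;> nlinarith
  · simp only [mul_add, Finset.sum_add_distrib]
    have h1 := hmgf s (abs_of_pos hs0)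
    have h2 := hmgf (-s) (by rw [abs_neg, abs_of_pos hs0])
    have h3 := exp_neg_mul_exp_le ht hL.le hv
    rw [← hs] at h3
    calc _ ≤ (Real.exp (s * t))⁻¹ * (Real.exp (n₂ * (144 * n₁ * p ^ 2) * s ^ 2) * n₁) +
          (Real.exp (s * t))⁻¹ * (Real.exp (n₂ * (144 * n₁ * p ^ 2) * s ^ 2) * n₁) := by gcongr
      _ = 2 * n₁ * ((Real.exp (s * t))⁻¹ * Real.exp (n₂ * (144 * n₁ * p ^ 2) * s ^ 2)) := by ring
      _ ≤ _ := by gcongr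

/-- A union bound over `n₁` linear statistics that are sums over the columns. -/
theorem IsBSBM.measureReal_linear_le (h : IsBSBM P A η₁ η₂ δ p)
    (hδ : δ ∈ Set.Ioo (0 : ℝ) 2) (hp : p ∈ Set.Ioo (0 : ℝ) (1 / 2)) {L t v : ℝ} (hL : 0 < L)
    (ht : 0 < t) (hv0 : 0 ≤ v) (hv : 12 * (n₂ * v) * L ≤ t ^ 2)
    (f : Matrix (Fin n₁) (Fin n₂) ℝ → Fin n₁ → ℝ) (g : Fin n₂ → (Fin n₁ → Bool) → Fin n₁ → ℝ)
    (hfg : ∀ c i, f (boolMatrix c) i = ∑ k, g k (c k) i)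
    (hg : ∀ r : ℝ, |r| = 6 * L / t → ∀ k i, ∑ a, columnWeight (edgeProb η₁ η₂ δ p k) a *
      Real.exp (r * g k a i) ≤ 1 + v * r ^ 2) :
    P.real {ω | ¬ ∀ i, |f (A ω) i| ≤ t} ≤ 2 * n₁ * Real.exp (-(3 * L)) := by
  set s := 6 * L / t with hs
  have hs0 : 0 < s := by positivity
  have hmgf : ∀ r : ℝ, |r| = s → ∀ i, ∑ c, jointWeight (edgeProb η₁ η₂ δ p) c *
      Real.exp (r * f (boolMatrix c) i) ≤ Real.exp (n₂ * v * s ^ 2) := by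
    intro r hr i
    have hr2 : r ^ 2 = s ^ 2 := by rw [← sq_abs, hr]
    simp only [hfg, Finset.mul_sum, Real.exp_sum]
    rw [sum_jointWeight_mul_prod _ fun k a => Real.exp (r * g k a i)]
    calc _ ≤ ∏ _k : Fin n₂, (1 + v * r ^ 2) := by
          refine Finset.prod_le_prod (fun k _ => Finset.sum_nonneg fun a _ => ?_)
            fun k _ => hg r hr k i
          exact mul_nonneg (columnWeight_nonneg (fun i => edgeProb_nonneg hδ hp k i)
            (fun i => edgeProb_le_one hδ hp k i) a) (Real.exp_pos _).le
      _ = (1 + v * r ^ 2) ^ n₂ := by simp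
      _ ≤ Real.exp (n₂ * (v * r ^ 2)) := one_add_pow_le_exp (by positivity) n₂
      _ = _ := by rw [hr2, mul_assoc]
  refine (h.measureReal_le hδ hp {B | ¬ ∀ i, |f B i| ≤ t}
    (fun c => ∑ i, (Real.exp (s * f (boolMatrix c) i) + Real.exp (-s * f (boolMatrix c) i)))
    (fun c => Finset.sum_nonneg fun i _ => by positivity) (Real.exp_pos (s * t))
    fun c hc => ?_).trans ?_
  · rw [Set.mem_ofPred_eq] at hc
    push Not at hc
    obtain ⟨i, hi⟩ := hc
    exact (exp_le_exp_add_exp_neg hs0 hi).trans (Finset.single_le_sum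
      (f := fun i => Real.exp (s * f (boolMatrix c) i) + Real.exp (-s * f (boolMatrix c) i))
      (fun j _ => by positivity) (Finset.mem_univ i))
  · have h3 := exp_neg_mul_exp_le ht hL.le hv
    rw [← hs] at h3
    calc _ = ∑ i, (Real.exp (s * t))⁻¹ *
          (∑ c, jointWeight (edgeProb η₁ η₂ δ p) c * Real.exp (s * f (boolMatrix c) i) +
          ∑ c, jointWeight (edgeProb η₁ η₂ δ p) c * Real.exp (-s * f (boolMatrix c) i)) := by
          rw [← Finset.mul_sum]
          simp only [Finset.mul_sum, mul_add, ← Finset.sum_add_distrib]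
          rw [Finset.sum_comm]
      _ ≤ ∑ _i : Fin n₁, (Real.exp (s * t))⁻¹ *
          (Real.exp (n₂ * v * s ^ 2) + Real.exp (n₂ * v * s ^ 2)) := by
          gcongr with i
          · exact hmgf s (abs_of_pos hs0) i
          · exact hmgf (-s) (by rw [abs_neg, abs_of_pos hs0]) i
      _ = 2 * n₁ * ((Real.exp (s * t))⁻¹ * Real.exp (n₂ * v * s ^ 2)) := by
          simp; ring
      _ ≤ _ := by gcongr

/-- An operator norm bound controls this vector only in ℓ₂; the Lloyd step needs every coordinate,
which is available for a fixed x. -/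
theorem IsBSBM.measureReal_noiseGram_mulVec_le (h : IsBSBM P A η₁ η₂ δ p)
    (hδ : δ ∈ Set.Ioo (0 : ℝ) 2) (hp : p ∈ Set.Ioo (0 : ℝ) (1 / 2)) {L t : ℝ} (hL : 0 < L)
    (ht : 0 < t) (hθ : 6 * L / t * (1 + 8 * n₁ * p) ≤ 1)
    (hv : 12 * (n₂ * (144 * n₁ * p ^ 2)) * L ≤ t ^ 2) {x : Fin n₁ → ℝ} (hx : ∀ i, |x i| ≤ 1) :
    P.real {ω | ¬ ∀ i, |(noiseGram η₁ η₂ δ p (A ω) *ᵥ x) i| ≤ t} ≤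
      2 * n₁ * Real.exp (-(3 * L)) := by
  refine h.measureReal_linear_le hδ hp hL ht (by positivity) hv
    (fun B => noiseGram η₁ η₂ δ p B *ᵥ x)
    (fun k a => hollowOuter (centeredColumn (edgeProb η₁ η₂ δ p k) a) *ᵥ x)
    (fun c i => by rw [noiseGram_boolMatrix, Matrix.sum_mulVec, Finset.sum_apply])
    fun r hr k i => ?_
  have := sum_columnWeight_mul_exp_hollowOuter_mulVec_le
    (q := edgeProb η₁ η₂ δ p k) (fun i => edgeProb_nonneg hδ hp k i)
    (fun i => edgeProb_le_one hδ hp k i) (fun i => edgeProb_le_two_mul hδ hp k i) hp.1.le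
    (s := r) (by rwa [hr, Fintype.card_fin]) hx i
  rwa [Fintype.card_fin] at this

theorem IsBSBM.measureReal_noise_mulVec_le (h : IsBSBM P A η₁ η₂ δ p)
    (hδ : δ ∈ Set.Ioo (0 : ℝ) 2) (hp : p ∈ Set.Ioo (0 : ℝ) (1 / 2)) {L t : ℝ} (hL : 0 < L)
    (ht : 0 < t) (hθ : 6 * L / t ≤ 1) (hv : 12 * (n₂ * (6 * p)) * L ≤ t ^ 2)
    {x : Fin n₂ → ℝ} (hx : ∀ k, |x k| ≤ 1) :
    P.real {ω | ¬ ∀ i, |(noise η₁ η₂ δ p (A ω) *ᵥ x) i| ≤ t} ≤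
      2 * n₁ * Real.exp (-(3 * L)) := by
  have hp0 := hp.1
  refine h.measureReal_linear_le hδ hp hL ht (by positivity) hv
    (fun B => noise η₁ η₂ δ p B *ᵥ x)
    (fun k a i => centeredColumn (edgeProb η₁ η₂ δ p k) a i * x k)
    (fun c i => by simp [Matrix.mulVec, dotProduct, noise_boolMatrix]) fun r hr k i => ?_
  have hrx : |r * x k| ≤ |r| := by
    rw [abs_mul]
    exact mul_le_of_le_one_right (abs_nonneg _) (hx k)
  have h1 := sum_bernoulliWeight_mul_exp_centered_le
    (edgeProb_nonneg (η₁ := η₁) (η₂ := η₂) hδ hp k i)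
    (edgeProb_le_one hδ hp k i) (edgeProb_le_two_mul hδ hp k i) (s := r * x k)
    (hrx.trans (hr.le.trans hθ))
  rw [← sum_columnWeight_mul_apply (edgeProb η₁ η₂ δ p k) i
    fun b => Real.exp (r * x k * centered (edgeProb η₁ η₂ δ p k i) b)] at h1
  calc _ = ∑ a, columnWeight (edgeProb η₁ η₂ δ p k) a *
        Real.exp (r * x k * centered (edgeProb η₁ η₂ δ p k i) (a i)) := by
        refine Finset.sum_congr rfl fun a _ => ?_
        rw [centeredColumn]
        ring_nf
    _ ≤ 1 + 6 * p * (r * x k) ^ 2 := h1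
    _ ≤ 1 + 6 * p * r ^ 2 := by
        have := sq_le_sq.2 hrx
        gcongr

end Chernoff

end BSBM

end

noncomputable section

namespace BSBM

open Matrix

/-! ### Signs, labelings and mismatches -/

section Sign

theorem sgn_eq_or {s₀ : ℝ} (hs : s₀ = 1 ∨ s₀ = -1) (y : ℝ) : sgn s₀ y = 1 ∨ sgn s₀ y = -1 := by
  unfold sgn
  split_ifs
  · exact Or.inl rfl
  · exact Or.inr rfl
  · exact hs

/-- The non-strict inequality includes y = 0, so the convention for the sign of 0 plays no further
role. -/
theorem mul_nonpos_of_sgn_ne {s₀ τ y : ℝ} (hτ : τ = 1 ∨ τ = -1) (h : sgn s₀ y ≠ τ) :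
    τ * y ≤ 0 := by
  by_contra hy
  push Not at hy
  apply h
  unfold sgn
  rcases hτ with rfl | rfl
  · rw [if_pos (by linarith)]
  · rw [if_neg (by linarith), if_pos (by linarith)]

theorem IsLabeling.mul_self {n : ℕ} {η : Fin n → ℝ} (hη : IsLabeling η) (i : Fin n) :
    η i * η i = 1 := by
  rcases hη i with h | h <;> rw [h] <;> norm_num

theorem IsLabeling.abs_eq {n : ℕ} {η : Fin n → ℝ} (hη : IsLabeling η) (i : Fin n) :
    |η i| = 1 := by
  rcases hη i with h | h <;> rw [h] <;> norm_num

theorem IsLabeling.dotProduct_self {n : ℕ} {η : Fin n → ℝ} (hη : IsLabeling η) :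
    η ⬝ᵥ η = n := by
  simp [dotProduct, hη.mul_self]

/-- Number of coordinates in which two vectors differ. -/
def mismatches {n : ℕ} (x y : Fin n → ℝ) : Finset (Fin n) :=
  Finset.univ.filter fun i => x i ≠ y i

theorem mem_mismatches {n : ℕ} {x y : Fin n → ℝ} {i : Fin n} :
    i ∈ mismatches x y ↔ x i ≠ y i := by
  rw [mismatches, Finset.mem_filter]
  exact and_iff_right (Finset.mem_univ i)

theorem IsLabeling.smul {n : ℕ} {η : Fin n → ℝ} (hη : IsLabeling η) {ν : ℝ}
    (hν : ν = 1 ∨ ν = -1) : IsLabeling (ν • η) := by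
  intro i
  rcases hν with rfl | rfl <;> rcases hη i with h | h <;> simp [h]

theorem isLabeling_signVec {n : ℕ} {s₀ : ℝ} (hs : s₀ = 1 ∨ s₀ = -1) (x : Fin n → ℝ) :
    IsLabeling (signVec s₀ x) := fun i => sgn_eq_or hs (x i)

theorem isLabeling_lloyd {n₁ n₂ : ℕ} {s₀ : ℝ} (hs : s₀ = 1 ∨ s₀ = -1)
    (A : Matrix (Fin n₁) (Fin n₂) ℝ) (v : Fin n₁ → ℝ) (k : ℕ) : IsLabeling (lloyd s₀ A v k) := by
  cases k <;> exact isLabeling_signVec hs _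

theorem loss_eq_zero {n : ℕ} {η x : Fin n → ℝ} {ν : ℝ} (hν : ν = 1 ∨ ν = -1) (h : x = ν • η) :
    loss η x = 0 := by
  have hnn : ∀ y z : Fin n → ℝ, 0 ≤ l1Dist y z := fun y z =>
    Finset.sum_nonneg fun i _ => abs_nonneg _
  have h0 : ∀ y : Fin n → ℝ, l1Dist y y = 0 := fun y => by simp [l1Dist]
  unfold loss
  rcases hν with rfl | rfl
  · rw [h, one_smul, h0]
    exact min_eq_left (hnn _ _)
  · rw [h, neg_smul, one_smul, h0]
    exact min_eq_right (hnn _ _)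

end Sign

/-! ### Deterministic analysis of the spectral start and of Lloyd steps -/

section Recovery

variable {n : ℕ} {η : Fin n → ℝ} {G : Matrix (Fin n) (Fin n) ℝ} {s s₀ : ℝ}

/-- The signs of the top eigenvector of a small perturbation of `s η ηᵀ` agree with `± η` on most
coordinates. -/
theorem exists_card_mismatches_le (hη : IsLabeling η) (hn : 0 < n) (hs : 0 < s) (hG : G.IsSymm)
    (hquad : ∀ x, |x ⬝ᵥ G *ᵥ x - s * (η ⬝ᵥ x) ^ 2| ≤ s * n / 32 * (x ⬝ᵥ x)) {v : Fin n → ℝ}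
    (hv : IsTopEigenvector G v) :
    ∃ ν : ℝ, (ν = 1 ∨ ν = -1) ∧ ((mismatches (signVec s₀ v) (ν • η)).card : ℝ) ≤ n / 8 := by
  obtain ⟨lam, hlam, hv0, hmax⟩ := dotProduct_mulVec_le_of_isTopEigenvector hG hv
  have hn' : (0 : ℝ) < n := by exact_mod_cast hn
  have hr : 0 < v ⬝ᵥ v := by
    refine lt_of_le_of_ne (Finset.sum_nonneg fun i _ => mul_self_nonneg _) fun h => hv0 ?_
    exact dotProduct_self_eq_zero.1 h.symm
  have h1 := hmax η
  have h2 := abs_le.1 (hquad η)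
  rw [hη.dotProduct_self] at h1 h2
  have h3 := abs_le.1 (hquad v)
  rw [hlam, dotProduct_smul, smul_eq_mul] at h3
  have hlam' : 31 / 32 * (s * n) ≤ lam := by
    have : 31 / 32 * (s * n) * n ≤ lam * n := by nlinarith
    exact le_of_mul_le_mul_right this hn'
  -- Testing with η gives the eigenvalue at least 31/32 of sn; evaluating the form at v loses
  -- another 1/32.
  have hcorr : 15 / 16 * (n * (v ⬝ᵥ v)) ≤ (η ⬝ᵥ v) ^ 2 := by
    have : s * (15 / 16 * (n * (v ⬝ᵥ v))) ≤ s * (η ⬝ᵥ v) ^ 2 := by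
      nlinarith [mul_le_mul_of_nonneg_right hlam' hr.le]
    exact le_of_mul_le_mul_left this hs
  set c : ℝ := (η ⬝ᵥ v) / n with hc
  have hcn : η ⬝ᵥ v = c * n := by rw [hc]; field_simp
  rw [hcn] at hcorr
  have hc2 : 15 / 16 * (v ⬝ᵥ v) ≤ n * c ^ 2 := by
    have : n * (15 / 16 * (v ⬝ᵥ v)) ≤ n * (n * c ^ 2) := by nlinarith
    exact le_of_mul_le_mul_left this hn'
  have hdist : ∑ i, (v i - c * η i) ^ 2 = v ⬝ᵥ v - n * c ^ 2 := by
    have e : ∀ i, (v i - c * η i) ^ 2 = v i * v i - 2 * c * (η i * v i) + c ^ 2 := fun i => by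
      linear_combination c ^ 2 * hη.mul_self i
    simp only [e, Finset.sum_add_distrib, Finset.sum_sub_distrib, ← Finset.mul_sum]
    have e2 : ∑ i, η i * v i = c * n := hcn
    rw [e2, dotProduct]
    simp
    ring
  obtain ⟨ν, hν, hνc⟩ : ∃ ν : ℝ, (ν = 1 ∨ ν = -1) ∧ ν * c = |c| := by
    rcases le_total 0 c with h | h
    · exact ⟨1, Or.inl rfl, by rw [one_mul, abs_of_nonneg h]⟩
    · exact ⟨-1, Or.inr rfl, by rw [abs_of_nonpos h]; ring⟩
  refine ⟨ν, hν, ?_⟩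
  -- cη is the projection of v onto η. At a wrong sign, v i and c η i do not share a strict sign, so
  -- they are at least |c| apart.
  have hmis : ∀ i ∈ mismatches (signVec s₀ v) (ν • η), c ^ 2 ≤ (v i - c * η i) ^ 2 := by
    intro i hi
    have hne : sgn s₀ (v i) ≠ (ν • η) i := mem_mismatches.1 hi
    have hle := mul_nonpos_of_sgn_ne (hη.smul hν i) hne
    rw [Pi.smul_apply, smul_eq_mul] at hle
    have hνν : ν * ν = 1 := by rcases hν with rfl | rfl <;> norm_num
    have hcv : c * (η i * v i) ≤ 0 := by
      have : c * (η i * v i) = |c| * (ν * η i * v i) := by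
        rw [← hνc]; linear_combination (-c * η i * v i) * hνν
      rw [this]
      exact mul_nonpos_of_nonneg_of_nonpos (abs_nonneg c) hle
    have e : (v i - c * η i) ^ 2 = v i ^ 2 - 2 * (c * (η i * v i)) + c ^ 2 := by
      linear_combination c ^ 2 * hη.mul_self i
    rw [e]
    nlinarith [sq_nonneg (v i)]
  have hcard : ((mismatches (signVec s₀ v) (ν • η)).card : ℝ) * c ^ 2 ≤ v ⬝ᵥ v - n * c ^ 2 := by
    rw [← hdist, ← nsmul_eq_mul]
    exact (Finset.card_nsmul_le_sum _ _ _ hmis).trans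
      (Finset.sum_le_sum_of_subset_of_nonneg (Finset.subset_univ _) fun _ _ _ => sq_nonneg _)
  have hc0 : 0 < c ^ 2 := by
    by_contra h
    nlinarith
  -- The squared distance to the projection is at most nc²/15, which leaves room below nc²/8.
  have : ((mismatches (signVec s₀ v) (ν • η)).card : ℝ) * c ^ 2 ≤ n / 8 * c ^ 2 := by nlinarith
  exact le_of_mul_le_mul_right this hc0

variable {D S : Matrix (Fin n) (Fin n) ℝ} {κ : ℝ}

theorem sq_sum_abs_le (x : Fin n → ℝ) : (∑ i, |x i|) ^ 2 ≤ n * (x ⬝ᵥ x) := by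
  have := sq_sum_le_card_mul_sum_sq (s := Finset.univ) (f := fun j => |x j|)
  simpa [dotProduct, ← pow_two] using this

theorem abs_dotProduct_mulVec_le_of_entries (hκ : 0 ≤ κ)
    (hD : ∀ i j, |D i j| ≤ κ + if i = j then s else 0) (x : Fin n → ℝ) :
    |x ⬝ᵥ D *ᵥ x| ≤ (κ * n + s) * (x ⬝ᵥ x) := by
  have hxx : x ⬝ᵥ x = ∑ i, |x i| * |x i| := by simp [dotProduct]
  calc |x ⬝ᵥ D *ᵥ x| ≤ ∑ i, ∑ j, |x i| * ((κ + if i = j then s else 0) * |x j|) := by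
        simp only [dotProduct, Matrix.mulVec, Finset.mul_sum]
        refine (Finset.abs_sum_le_sum_abs _ _).trans (Finset.sum_le_sum fun i _ => ?_)
        refine (Finset.abs_sum_le_sum_abs _ _).trans (Finset.sum_le_sum fun j _ => ?_)
        rw [abs_mul, abs_mul]
        exact mul_le_mul_of_nonneg_left (mul_le_mul_of_nonneg_right (hD i j) (abs_nonneg _))
          (abs_nonneg _)
    _ = κ * (∑ i, |x i|) ^ 2 + s * (x ⬝ᵥ x) := by
        rw [hxx, pow_two, Finset.sum_mul_sum, Finset.mul_sum, Finset.mul_sum,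
          ← Finset.sum_add_distrib]
        refine Finset.sum_congr rfl fun i _ => ?_
        simp only [add_mul, mul_add, Finset.sum_add_distrib, ite_mul, zero_mul, mul_ite, mul_zero,
          Finset.sum_ite_eq, Finset.mem_univ, if_true, Finset.mul_sum]
        congr 1
        · exact Finset.sum_congr rfl fun j _ => by ring
        · ring
    _ ≤ κ * (n * (x ⬝ᵥ x)) + s * (x ⬝ᵥ x) := by
        gcongr
        exact sq_sum_abs_le x
    _ = _ := by ring

theorem abs_mulVec_le_of_entries
    (hD : ∀ i j, |D i j| ≤ κ + if i = j then s else 0) {x : Fin n → ℝ} (hx : ∀ i, |x i| ≤ 1)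
    (i : Fin n) : |(D *ᵥ x) i| ≤ κ * n + s := by
  calc |(D *ᵥ x) i| ≤ ∑ j, (κ + if i = j then s else 0) := by
        simp only [Matrix.mulVec, dotProduct]
        refine (Finset.abs_sum_le_sum_abs _ _).trans
          (Finset.sum_le_sum fun j _ => ?_)
        rw [abs_mul]
        exact (mul_le_of_le_one_right (abs_nonneg _) (hx j)).trans (hD i j)
    _ = _ := by
        simp [Finset.sum_add_distrib, mul_comm]

/-- One hollowed Lloyd step divides the number of errors by at least four. -/
theorem card_mismatches_signVec_mulVec_le (hη : IsLabeling η) (hn : 100 ≤ n) (hs : 0 < s)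
    (hGDS : ∀ i j, G i j = s * (η i * η j) + D i j + S i j)
    (hD : ∀ i j, |D i j| ≤ s / 64 + if i = j then s else 0) (hSs : S.IsSymm)
    (hS : ∀ x, |x ⬝ᵥ S *ᵥ x| ≤ s * n / 500 * (x ⬝ᵥ x)) (hSη : ∀ i, |(S *ᵥ η) i| ≤ s * n / 500)
    {ν : ℝ} (hν : ν = 1 ∨ ν = -1) {x : Fin n → ℝ} (hx : IsLabeling x)
    (he : ((mismatches x (ν • η)).card : ℝ) ≤ n / 8) :
    ((mismatches (signVec s₀ (G *ᵥ x)) (ν • η)).card : ℝ) ≤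
      ((mismatches x (ν • η)).card : ℝ) / 4 := by
  have hn' : (100 : ℝ) ≤ n := by exact_mod_cast hn
  have hν1 : |ν| = 1 := by rcases hν with rfl | rfl <;> norm_num
  have hνν : ν * ν = 1 := by rcases hν with rfl | rfl <;> norm_num
  set e : ℝ := ((mismatches x (ν • η)).card : ℝ) with hedef
  set z : Fin n → ℝ := x - ν • η with hz
  have hνη := hη.smul hν
  have hprod : ∀ i, (ν • η) i * x i = 1 - if i ∈ mismatches x (ν • η) then 2 else 0 := by
    intro i
    by_cases h : x i = (ν • η) i
    · have : i ∉ mismatches x (ν • η) := fun h' => mem_mismatches.1 h' h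
      rw [if_neg this, h, hνη.mul_self, sub_zero]
    · have : i ∈ mismatches x (ν • η) := mem_mismatches.2 h
      rw [if_pos this]
      rcases hνη i with h1 | h1 <;> rcases hx i with h2 | h2 <;> rw [h1, h2] at h ⊢ <;>
        first | exact absurd rfl h | norm_num
  have hcorr : ν * (η ⬝ᵥ x) = n - 2 * e := by
    have : ν * (η ⬝ᵥ x) = ∑ i, (ν • η) i * x i := by
      simp [dotProduct, Finset.mul_sum, mul_assoc]
    rw [this]
    simp only [hprod, Finset.sum_sub_distrib, Finset.sum_ite_mem, Finset.univ_inter,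
      Finset.sum_const, nsmul_eq_mul, Finset.card_univ, Fintype.card_fin, hedef]
    ring
  have hzz : z ⬝ᵥ z = 4 * e := by
    have : ∀ i, z i * z i = 2 - 2 * ((ν • η) i * x i) := fun i => by
      have h1 := hνη.mul_self i
      have h2 := hx.mul_self i
      rw [hz, Pi.sub_apply]
      linear_combination h1 + h2
    simp only [dotProduct, this, hprod, Finset.sum_sub_distrib, ← Finset.mul_sum,
      Finset.sum_ite_mem, Finset.univ_inter, Finset.sum_const, nsmul_eq_mul, Finset.card_univ,
      Fintype.card_fin, hedef]
    ring
  -- The noise acts on the fixed vector η, where a sup-norm bound holds, and on the data-dependent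
  -- remainder z, where only the operator norm is used.
  have hGx : ∀ i, (G *ᵥ x) i = s * (η i * (η ⬝ᵥ x)) + (D *ᵥ x) i + (ν * (S *ᵥ η) i + (S *ᵥ z) i) := by
    intro i
    have hSx : ν * (S *ᵥ η) i + (S *ᵥ z) i = (S *ᵥ x) i := by
      rw [hz, Matrix.mulVec_sub, Matrix.mulVec_smul]
      simp
    rw [hSx]
    simp only [Matrix.mulVec, dotProduct, Finset.mul_sum, ← Finset.sum_add_distrib, hGDS]
    exact Finset.sum_congr rfl fun j _ => by ring
  -- The signal is s(n-2e) ≥ 3sn/4. The losses are sn/64, s ≤ sn/100 (as n ≥ 100) and sn/500, so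
  -- more than sn/2 is left for Sz to cancel.
  have hbad : ∀ i ∈ mismatches (signVec s₀ (G *ᵥ x)) (ν • η), (s * n / 2) ^ 2 ≤ (S *ᵥ z) i ^ 2 := by
    intro i hi
    have hne : sgn s₀ ((G *ᵥ x) i) ≠ (ν • η) i := mem_mismatches.1 hi
    have hle := mul_nonpos_of_sgn_ne (hνη i) hne
    have hd := abs_mulVec_le_of_entries hD (fun j => (hx.abs_eq j).le) i
    have habs : ∀ y : ℝ, |(ν • η) i * y| = |y| := fun y => by rw [abs_mul, hνη.abs_eq, one_mul]
    have h1 : (ν • η) i * (G *ᵥ x) i = s * (ν * (η ⬝ᵥ x)) + (ν • η) i * (D *ᵥ x) i +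
        ((ν • η) i * (ν * (S *ᵥ η) i) + (ν • η) i * (S *ᵥ z) i) := by
      rw [hGx, Pi.smul_apply, smul_eq_mul]
      linear_combination s * ν * (η ⬝ᵥ x) * hη.mul_self i
    have h2 := neg_abs_le ((ν • η) i * (D *ᵥ x) i)
    have h3 := neg_abs_le ((ν • η) i * (ν * (S *ᵥ η) i))
    have h4 := neg_abs_le ((ν • η) i * (S *ᵥ z) i)
    have h5 := hSη i
    rw [habs] at h2 h3 h4
    rw [abs_mul, hν1, one_mul] at h3
    rw [h1, hcorr] at hle
    rw [← sq_abs ((S *ᵥ z) i)]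
    refine pow_le_pow_left₀ (by positivity) ?_ 2
    nlinarith [mul_le_mul_of_nonneg_left he hs.le, mul_le_mul_of_nonneg_left hn' hs.le]
  have hsum : ∑ i, (S *ᵥ z) i ^ 2 ≤ (s * n / 500) ^ 2 * (4 * e) := by
    have := mulVec_dotProduct_mulVec_le hSs hS z
    rw [hzz] at this
    simpa [dotProduct, ← pow_two] using this
  have hcard : ((mismatches (signVec s₀ (G *ᵥ x)) (ν • η)).card : ℝ) * (s * n / 2) ^ 2 ≤
      (s * n / 500) ^ 2 * (4 * e) := by
    refine le_trans ?_ hsum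
    rw [← nsmul_eq_mul]
    exact (Finset.card_nsmul_le_sum _ _ _ hbad).trans
      (Finset.sum_le_sum_of_subset_of_nonneg (Finset.subset_univ _) fun _ _ _ => sq_nonneg _)
  have hsn : 0 < (s * n) ^ 2 := by positivity
  have he0 : 0 ≤ e := Nat.cast_nonneg _
  have : ((mismatches (signVec s₀ (G *ᵥ x)) (ν • η)).card : ℝ) * (s * n) ^ 2 ≤
      e / 4 * (s * n) ^ 2 := by nlinarith [mul_nonneg he0 hsn.le]
  exact le_of_mul_le_mul_right this hsn

/-- On the good event no probability remains: the spectral start gives n/8 errors and the one-step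
contraction is iterated with the same ν. -/
theorem loss_lloyd_eq_zero {n₂ : ℕ} {A : Matrix (Fin n) (Fin n₂) ℝ} (hη : IsLabeling η)
    (hn : 100 ≤ n) (hs : 0 < s) (hG : (hollowedGram A).IsSymm)
    (hGDS : ∀ i j, hollowedGram A i j = s * (η i * η j) + D i j + S i j)
    (hD : ∀ i j, |D i j| ≤ s / 64 + if i = j then s else 0) (hSs : S.IsSymm)
    (hS : ∀ x, |x ⬝ᵥ S *ᵥ x| ≤ s * n / 500 * (x ⬝ᵥ x)) (hSη : ∀ i, |(S *ᵥ η) i| ≤ s * n / 500)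
    (hs₀ : s₀ = 1 ∨ s₀ = -1) {v : Fin n → ℝ} (hv : IsTopEigenvector (hollowedGram A) v) {m : ℕ}
    (hm : Real.log n / (2 * Real.log 2) - 3 / 2 < m) : loss η (lloyd s₀ A v m) = 0 := by
  have hn' : (100 : ℝ) ≤ n := by exact_mod_cast hn
  have hquad : ∀ x, |x ⬝ᵥ hollowedGram A *ᵥ x - s * (η ⬝ᵥ x) ^ 2| ≤ s * n / 32 * (x ⬝ᵥ x) := by
    intro x
    have hmv : hollowedGram A *ᵥ x = fun i => s * (η i * (η ⬝ᵥ x)) + (D *ᵥ x) i + (S *ᵥ x) i := by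
      funext i
      simp only [Matrix.mulVec, dotProduct, Finset.mul_sum, ← Finset.sum_add_distrib, hGDS]
      exact Finset.sum_congr rfl fun j _ => by ring
    have e : x ⬝ᵥ hollowedGram A *ᵥ x - s * (η ⬝ᵥ x) ^ 2 = x ⬝ᵥ D *ᵥ x + x ⬝ᵥ S *ᵥ x := by
      have e1 : s * (η ⬝ᵥ x) ^ 2 = ∑ i, x i * (s * (η i * (η ⬝ᵥ x))) := by
        have : η ⬝ᵥ x * (s * (η ⬝ᵥ x)) = ∑ i, η i * x i * (s * (η ⬝ᵥ x)) := by
          rw [← Finset.sum_mul, dotProduct]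
        rw [show s * (η ⬝ᵥ x) ^ 2 = η ⬝ᵥ x * (s * (η ⬝ᵥ x)) by ring, this]
        exact Finset.sum_congr rfl fun i _ => by ring
      rw [e1, hmv]
      simp only [dotProduct, mul_add, Finset.sum_add_distrib]
      ring
    rw [e]
    have h1 := abs_dotProduct_mulVec_le_of_entries (by positivity) hD x
    have hxx : 0 ≤ x ⬝ᵥ x := Finset.sum_nonneg fun i _ => mul_self_nonneg _
    refine (abs_add_le _ _).trans ((add_le_add h1 (hS x)).trans ?_)
    rw [← add_mul]
    refine mul_le_mul_of_nonneg_right ?_ hxx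
    -- The sum 1/64 + 1/100 + 1/500 is below 1/32; the middle term is the diagonal of D, using n ≥
    -- 100.
    nlinarith
  obtain ⟨ν, hν, hinit⟩ := exists_card_mismatches_le (s₀ := s₀) hη (by omega) hs hG hquad hv
  have hk : ∀ k, ((mismatches (lloyd s₀ A v k) (ν • η)).card : ℝ) ≤ n / 8 / 4 ^ k := by
    intro k
    induction k with
    | zero => simpa only [lloyd, pow_zero, div_one] using hinit
    | succ k ih =>
      have hle : (n : ℝ) / 8 / 4 ^ k ≤ n / 8 :=
        div_le_self (by positivity) (one_le_pow₀ (by norm_num))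
      have := card_mismatches_signVec_mulVec_le (s₀ := s₀) hη hn hs hGDS hD hSs hS hSη hν
        (isLabeling_lloyd hs₀ A v k) (ih.trans hle)
      refine this.trans ?_
      rw [pow_succ, ← div_div]
      linarith
  -- The hypothesis on m rearranges to n < 2^(2m+3) = 8·4^m.
  have hlt : (n : ℝ) / 8 / 4 ^ m < 1 := by
    have hlog2 : 0 < Real.log 2 := Real.log_pos (by norm_num)
    have h1 : Real.log n < (2 * m + 3 : ℕ) * Real.log 2 := by
      rw [sub_lt_iff_lt_add, div_lt_iff₀ (by positivity)] at hm
      push_cast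
      linarith
    rw [← Real.log_pow] at h1
    have h2 := (Real.log_lt_log_iff (by positivity) (by positivity)).1 h1
    rw [div_div, div_lt_one (by positivity)]
    refine h2.trans_le (le_of_eq ?_)
    rw [pow_add, pow_mul]
    norm_num
    ring
  have hzero : mismatches (lloyd s₀ A v m) (ν • η) = ∅ := by
    rw [← Finset.card_eq_zero]
    have := (hk m).trans_lt hlt
    have : (mismatches (lloyd s₀ A v m) (ν • η)).card < 1 := by exact_mod_cast this
    omega
  refine loss_eq_zero hν (funext fun i => ?_)
  by_contra h
  have : i ∈ mismatches (lloyd s₀ A v m) (ν • η) := mem_mismatches.2 h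
  rw [hzero] at this
  simp at this

end Recovery

end BSBM

end

noncomputable section

namespace BSBM

open Matrix

/-! ### Decomposition of the hollowed Gram matrix -/

section Gram

variable {n₁ n₂ : ℕ} {η₁ : Fin n₁ → ℝ} {η₂ : Fin n₂ → ℝ} {δ p : ℝ}

theorem IsLabeling.imbalance_eq {n : ℕ} {η : Fin n → ℝ} (hη : IsLabeling η) :
    imbalance η = |∑ i, η i| / n := by
  have h : ∑ i, η i = ({i : Fin n | η i = 1}.ncard : ℝ) - ({i : Fin n | η i = -1}.ncard : ℝ) := by
    have hc : ∀ r : ℝ, (({i : Fin n | η i = r}.ncard : ℕ) : ℝ) =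
        ∑ i, if η i = r then (1 : ℝ) else 0 := fun r => by
      rw [Finset.sum_boole, Set.ncard_eq_toFinset_card']
      simp
    rw [hc, hc, ← Finset.sum_sub_distrib]
    refine Finset.sum_congr rfl fun i _ => ?_
    rcases hη i with h | h <;> rw [h] <;> norm_num
  rw [imbalance, h]

theorem edgeProb_eq (h₁ : IsLabeling η₁) (h₂ : IsLabeling η₂) (k : Fin n₂) (i : Fin n₁) :
    edgeProb η₁ η₂ δ p k i = p + (δ - 1) * p * (η₁ i * η₂ k) := by
  unfold edgeProb
  rcases h₁ i with h | h <;> rcases h₂ k with h' | h' <;> rw [h, h'] <;> norm_num <;> ring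

theorem apply_eq_noise_add (h₁ : IsLabeling η₁) (h₂ : IsLabeling η₂)
    (A : Matrix (Fin n₁) (Fin n₂) ℝ) (i : Fin n₁) (k : Fin n₂) :
    A i k = noise η₁ η₂ δ p A i k + p + (δ - 1) * p * (η₁ i * η₂ k) := by
  simp only [noise, Matrix.sub_apply, Matrix.of_apply, edgeProb_eq h₁ h₂]
  ring

theorem pHat_sub_eq (h₁ : IsLabeling η₁) (h₂ : IsLabeling η₂) (hn₁ : 0 < n₁) (hn₂ : 0 < n₂)
    (A : Matrix (Fin n₁) (Fin n₂) ℝ) :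
    pHat A - p = ((δ - 1) * p * ((∑ i, η₁ i) * ∑ k, η₂ k) +
      ∑ i, (noise η₁ η₂ δ p A *ᵥ fun _ => 1) i) / (n₁ * n₂) := by
  have hn₁' : (n₁ : ℝ) ≠ 0 := by positivity
  have hn₂' : (n₂ : ℝ) ≠ 0 := by positivity
  have h : ∑ i, ∑ k, A i k = n₁ * n₂ * p + ((δ - 1) * p * ((∑ i, η₁ i) * ∑ k, η₂ k) +
      ∑ i, (noise η₁ η₂ δ p A *ᵥ fun _ => 1) i) := by
    rw [Finset.sum_congr rfl fun i _ => Finset.sum_congr rfl fun k _ =>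
      apply_eq_noise_add (δ := δ) (p := p) h₁ h₂ A i k]
    simp only [Finset.sum_add_distrib, Finset.sum_const, Finset.card_univ, Fintype.card_fin,
      nsmul_eq_mul, ← Finset.mul_sum, Matrix.mulVec, dotProduct, mul_one, Finset.sum_mul_sum]
    ring
  rw [pHat, h]
  field_simp
  ring

/-- Multiply out rows i and j of Â = N + aη₁η₂ᵀ - (p̂-p)11ᵀ with a = (δ-1)p. -/
theorem hollowedGram_apply_of_ne (h₁ : IsLabeling η₁) (h₂ : IsLabeling η₂)
    (A : Matrix (Fin n₁) (Fin n₂) ℝ) {i j : Fin n₁} (hij : i ≠ j) :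
    hollowedGram A i j = ((δ - 1) * p) ^ 2 * n₂ * (η₁ i * η₁ j) +
      ((δ - 1) * p * (η₁ i * (noise η₁ η₂ δ p A *ᵥ η₂) j + η₁ j * (noise η₁ η₂ δ p A *ᵥ η₂) i) -
      (pHat A - p) * ((noise η₁ η₂ δ p A *ᵥ fun _ => 1) i + (noise η₁ η₂ δ p A *ᵥ fun _ => 1) j) -
      (pHat A - p) * ((δ - 1) * p) * (∑ k, η₂ k) * (η₁ i + η₁ j) + (pHat A - p) ^ 2 * n₂) +
      noiseGram η₁ η₂ δ p A i j := by
  have hn₂ : (n₂ : ℝ) = ∑ k, η₂ k * η₂ k := by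
    simp [h₂.mul_self]
  have hn₂' : (pHat A - p) ^ 2 * n₂ = ∑ _k : Fin n₂, (pHat A - p) ^ 2 := by
    simp [mul_comm]
  rw [hn₂', hollowedGram, noiseGram, hollow_apply, hollow_apply, if_neg hij, if_neg hij, hn₂]
  simp only [Matrix.mul_apply, Matrix.transpose_apply, Matrix.mulVec, dotProduct, Finset.mul_sum,
    Finset.sum_mul, ← Finset.sum_add_distrib, ← Finset.sum_sub_distrib, corrected,
    Matrix.sub_apply, Matrix.of_apply]
  refine Finset.sum_congr rfl fun k _ => ?_
  rw [apply_eq_noise_add (δ := δ) (p := p) h₁ h₂ A i k,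
    apply_eq_noise_add (δ := δ) (p := p) h₁ h₂ A j k]
  ring

theorem hollowedGram_isSymm (A : Matrix (Fin n₁) (Fin n₂) ℝ) : (hollowedGram A).IsSymm :=
  hollow_isSymm (by rw [Matrix.IsSymm, Matrix.transpose_mul, Matrix.transpose_transpose])

/-- The bias of p̂ is a times the product of the two mean labels, so only the product γ₁γ₂ enters;
the fluctuation is an average of row sums of the noise. -/
theorem abs_pHat_sub_le (h₁ : IsLabeling η₁) (h₂ : IsLabeling η₂) (hn₁ : 0 < n₁) (hn₂ : 0 < n₂)
    {γ₁ γ₂ : ℝ} (hγ : γ₁ * γ₂ ≤ 1 / 480) (hi₁ : imbalance η₁ ≤ γ₁) (hi₂ : imbalance η₂ ≤ γ₂)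
    {A : Matrix (Fin n₁) (Fin n₂) ℝ}
    (hz : ∀ i, |(noise η₁ η₂ δ p A *ᵥ fun _ => 1) i| ≤ |(δ - 1) * p| * n₂ / 500) :
    |pHat A - p| ≤ |(δ - 1) * p| * (1 / 480 + 1 / 500) := by
  have hn₁' : (0 : ℝ) < n₁ := by exact_mod_cast hn₁
  have hn₂' : (0 : ℝ) < n₂ := by exact_mod_cast hn₂
  rw [h₁.imbalance_eq, div_le_iff₀ hn₁'] at hi₁
  rw [h₂.imbalance_eq, div_le_iff₀ hn₂'] at hi₂
  have hprod : |∑ i, η₁ i| * |∑ k, η₂ k| ≤ 1 / 480 * (n₁ * n₂) := by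
    calc |∑ i, η₁ i| * |∑ k, η₂ k| ≤ γ₁ * n₁ * (γ₂ * n₂) :=
          mul_le_mul hi₁ hi₂ (abs_nonneg _) ((abs_nonneg _).trans hi₁)
      _ = γ₁ * γ₂ * (n₁ * n₂) := by ring
      _ ≤ _ := by gcongr
  have hsum : |∑ i, (noise η₁ η₂ δ p A *ᵥ fun _ => 1) i| ≤ n₁ * (|(δ - 1) * p| * n₂ / 500) := by
    refine (Finset.abs_sum_le_sum_abs _ _).trans ((Finset.sum_le_sum fun i _ => hz i).trans ?_)
    simp
  rw [pHat_sub_eq (δ := δ) h₁ h₂ hn₁ hn₂, abs_div, abs_of_pos (mul_pos hn₁' hn₂'),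
    div_le_iff₀ (mul_pos hn₁' hn₂')]
  refine (abs_add_le _ _).trans ?_
  rw [abs_mul ((δ - 1) * p), abs_mul (∑ i, η₁ i)]
  nlinarith [mul_le_mul_of_nonneg_left hprod (abs_nonneg ((δ - 1) * p))]

/-- Deviation of the hollowed Gram matrix from the signal plus the Gram matrix of the noise. -/
theorem abs_hollowedGram_sub_le (h₁ : IsLabeling η₁) (h₂ : IsLabeling η₂) (hn₁ : 0 < n₁)
    (hn₂ : 0 < n₂) {γ₁ γ₂ : ℝ} (hγ : γ₁ * γ₂ ≤ 1 / 480) (hi₁ : imbalance η₁ ≤ γ₁)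
    (hi₂ : imbalance η₂ ≤ γ₂) {A : Matrix (Fin n₁) (Fin n₂) ℝ}
    (hz : ∀ i, |(noise η₁ η₂ δ p A *ᵥ fun _ => 1) i| ≤ |(δ - 1) * p| * n₂ / 500)
    (hy : ∀ i, |(noise η₁ η₂ δ p A *ᵥ η₂) i| ≤ |(δ - 1) * p| * n₂ / 500) (i j : Fin n₁) :
    |hollowedGram A i j - ((δ - 1) * p) ^ 2 * n₂ * (η₁ i * η₁ j) - noiseGram η₁ η₂ δ p A i j| ≤
      ((δ - 1) * p) ^ 2 * n₂ / 64 + if i = j then ((δ - 1) * p) ^ 2 * n₂ else 0 := by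
  by_cases hij : i = j
  · subst hij
    -- Both hollowed matrices vanish on the diagonal, where the deviation is therefore the whole
    -- signal entry.
    rw [hollowedGram, noiseGram, hollow_apply, hollow_apply, if_pos rfl, if_pos rfl, if_pos rfl,
      h₁.mul_self, mul_one, sub_zero, zero_sub, abs_neg, abs_of_nonneg (by positivity)]
    have : 0 ≤ ((δ - 1) * p) ^ 2 * n₂ / 64 := by positivity
    linarith
  · have hu := abs_pHat_sub_le h₁ h₂ hn₁ hn₂ hγ hi₁ hi₂ hz
    rw [hollowedGram_apply_of_ne (δ := δ) (p := p) h₁ h₂ A hij, if_neg hij, add_zero]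
    set a := (δ - 1) * p
    set u := pHat A - p
    set y := noise η₁ η₂ δ p A *ᵥ η₂
    set z := noise η₁ η₂ δ p A *ᵥ fun _ => 1
    have hT : |∑ k, η₂ k| ≤ n₂ := by
      refine (Finset.abs_sum_le_sum_abs _ _).trans (le_of_eq ?_)
      simp [h₂.abs_eq]
    have e1 : |a * (η₁ i * y j + η₁ j * y i)| ≤ |a| * (2 * (|a| * n₂ / 500)) := by
      rw [abs_mul]
      refine mul_le_mul_of_nonneg_left ((abs_add_le _ _).trans ?_) (abs_nonneg a)
      rw [abs_mul, abs_mul, h₁.abs_eq, h₁.abs_eq]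
      linarith [hy i, hy j]
    have e2 : |u * (z i + z j)| ≤ |a| * (1 / 480 + 1 / 500) * (2 * (|a| * n₂ / 500)) := by
      rw [abs_mul]
      refine mul_le_mul hu ((abs_add_le _ _).trans ?_) (abs_nonneg _) (by positivity)
      linarith [hz i, hz j]
    have e3 : |u * a * (∑ k, η₂ k) * (η₁ i + η₁ j)| ≤
        |a| * (1 / 480 + 1 / 500) * |a| * n₂ * 2 := by
      rw [abs_mul, abs_mul, abs_mul]
      have : |η₁ i + η₁ j| ≤ 2 := (abs_add_le _ _).trans (by
        rw [h₁.abs_eq, h₁.abs_eq]; norm_num)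
      gcongr
    have e4 : |u ^ 2 * n₂| ≤ (|a| * (1 / 480 + 1 / 500)) ^ 2 * n₂ := by
      rw [abs_mul, abs_pow, Nat.abs_cast]
      gcongr
    have hs : 0 ≤ a ^ 2 * n₂ := by positivity
    have haa : |a| * |a| = a ^ 2 := by rw [abs_mul_abs_self, pow_two]
    have f1 : |a| * (2 * (|a| * n₂ / 500)) = a ^ 2 * n₂ * (2 / 500) := by
      rw [← haa]; ring
    have f2 : |a| * (1 / 480 + 1 / 500) * (2 * (|a| * n₂ / 500)) =
        a ^ 2 * n₂ * ((1 / 480 + 1 / 500) * 2 / 500) := by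
      rw [← haa]; ring
    have f3 : |a| * (1 / 480 + 1 / 500) * |a| * n₂ * 2 =
        a ^ 2 * n₂ * ((1 / 480 + 1 / 500) * 2) := by
      rw [← haa]; ring
    have f4 : (|a| * (1 / 480 + 1 / 500)) ^ 2 * n₂ = a ^ 2 * n₂ * (1 / 480 + 1 / 500) ^ 2 := by
      rw [← haa]; ring
    rw [f1] at e1
    rw [f2] at e2
    rw [f3] at e3
    rw [f4] at e4
    rw [abs_le] at e1 e2 e3 e4 ⊢
    -- The coefficients add up to less than 0.0123 < 1/64. The largest is 2(1/480 + 1/500), from the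
    -- bias of p̂ against the signal.
    constructor <;> linarith

end Gram

/-! ### Consequences of the signal-to-noise condition -/

section Numerics

variable {n₁ n₂ : ℕ} {δ p : ℝ}

/-- Consequences of the signal-to-noise condition for the Chernoff bounds. -/
theorem signal_bounds (hn₁ : 2 ≤ n₁) (hn₂ : 2 ≤ n₂) (hδ : δ ∈ Set.Ioo (0 : ℝ) 2) (hδ1 : δ ≠ 1)
    (hp : 0 < p)
    (h : 20000000 * ((δ - 1) ^ 2)⁻¹ *
      max (Real.sqrt (Real.log n₁ / ((n₁ : ℝ) * (n₂ : ℝ)))) (Real.log n₁ / (n₂ : ℝ)) ≤ p) :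
    6 * Real.log n₁ * (1 + 8 * n₁ * p) ≤ ((δ - 1) * p) ^ 2 * n₂ * n₁ / 500 ∧
    12 * (n₂ * (144 * n₁ * p ^ 2)) * Real.log n₁ ≤
      (((δ - 1) * p) ^ 2 * n₂ * n₁ / 500) ^ 2 ∧
    6 * Real.log n₁ ≤ |(δ - 1) * p| * n₂ / 500 ∧
    12 * (n₂ * (6 * p)) * Real.log n₁ ≤ (|(δ - 1) * p| * n₂ / 500) ^ 2 := by
  have hn₁' : (2 : ℝ) ≤ n₁ := by exact_mod_cast hn₁
  have hn₂' : (2 : ℝ) ≤ n₂ := by exact_mod_cast hn₂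
  have hL : 0 < Real.log n₁ := Real.log_pos (by linarith)
  set L := Real.log n₁
  have hd0 : 0 < (δ - 1) ^ 2 := by
    have := sub_ne_zero.2 hδ1
    positivity
  have hd1 : (δ - 1) ^ 2 ≤ 1 := by nlinarith [hδ.1, hδ.2]
  have habs : |δ - 1| ≤ 1 := by
    rw [← sq_abs] at hd1
    nlinarith [abs_nonneg (δ - 1)]
  have hmul : ∀ {y : ℝ}, 20000000 * ((δ - 1) ^ 2)⁻¹ * y ≤ p → 20000000 * y ≤ (δ - 1) ^ 2 * p := by
    intro y hy
    have := mul_le_mul_of_nonneg_left hy hd0.le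
    calc 20000000 * y = (δ - 1) ^ 2 * (20000000 * ((δ - 1) ^ 2)⁻¹ * y) := by field_simp
      _ ≤ _ := this
  have hC0 : 0 ≤ 20000000 * ((δ - 1) ^ 2)⁻¹ := by positivity
  have h1 := hmul ((mul_le_mul_of_nonneg_left (le_max_left _ _) hC0).trans h)
  have h2 := hmul ((mul_le_mul_of_nonneg_left (le_max_right _ _) hC0).trans h)
  have hcol : 20000000 * L ≤ (δ - 1) ^ 2 * p * n₂ := by
    rw [← mul_div_assoc, div_le_iff₀ (by linarith)] at h2
    exact h2
  -- The square-root branch of the maximum, squared; `hcol` is the other branch.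
  have hall : 20000000 ^ 2 * L ≤ ((δ - 1) ^ 2 * p) ^ 2 * (n₁ * n₂) := by
    have h3 := pow_le_pow_left₀ (by positivity) h1 2
    rw [mul_pow, Real.sq_sqrt (by positivity), ← mul_div_assoc, div_le_iff₀ (by positivity)] at h3
    exact h3
  set d2 := (δ - 1) ^ 2
  have ht : ((δ - 1) * p) ^ 2 * n₂ * n₁ = d2 * p ^ 2 * (n₁ * n₂) := by
    simp only [d2]; ring
  have ht' : (|(δ - 1) * p| * n₂ / 500) ^ 2 = d2 * p ^ 2 * n₂ ^ 2 / 250000 := by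
    rw [div_pow, mul_pow, sq_abs]; simp only [d2]; ring
  refine ⟨?_, ?_, ?_, ?_⟩
  · rw [ht]
    have k1 : 20000000 ^ 2 * L ≤ d2 * p ^ 2 * (n₁ * n₂) := by
      refine hall.trans ?_
      have : 0 ≤ d2 * p ^ 2 * (n₁ * n₂) := by positivity
      nlinarith
    have k2 : 20000000 * L * (p * n₁) ≤ d2 * p ^ 2 * (n₁ * n₂) := by
      have := mul_le_mul_of_nonneg_right hcol (show 0 ≤ p * n₁ by positivity)
      linarith
    have k3 : 0 ≤ L * (p * n₁) := by positivity
    linarith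
  · rw [ht, div_pow]
    have k1 := mul_le_mul_of_nonneg_right hall (show 0 ≤ p ^ 2 * (n₁ * n₂) by positivity)
    have k2 : 0 ≤ L * (p ^ 2 * (n₁ * n₂)) := by positivity
    rw [le_div_iff₀ (by norm_num)]
    linarith
  · have : |(δ - 1) * p| * n₂ = |δ - 1| * (p * n₂) := by
      rw [abs_mul, abs_of_pos hp]; ring
    rw [this]
    have k1 : d2 * p * n₂ ≤ |δ - 1| * (p * n₂) := by
      rw [mul_assoc]
      refine mul_le_mul_of_nonneg_right ?_ (by positivity)
      simp only [d2]
      rw [← sq_abs]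
      nlinarith [abs_nonneg (δ - 1)]
    linarith
  -- This bound dictates the size of the constant: 12·6·500² = 18000000 must not exceed 20000000.
  · rw [ht', le_div_iff₀ (by norm_num)]
    have k1 := mul_le_mul_of_nonneg_right hcol (show 0 ≤ p * n₂ by positivity)
    have k2 : 0 ≤ L * (p * n₂) := by positivity
    linarith

theorem natCast_mul_exp_neg_log_le {n : ℕ} (hn : 1 ≤ n) :
    (n : ℝ) * Real.exp (-(3 * Real.log n)) ≤ 1 / n := by
  have hn' : (1 : ℝ) ≤ n := by exact_mod_cast hn
  have h : Real.exp (3 * Real.log n) = (n : ℝ) ^ 3 := by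
    have := Real.exp_nat_mul (Real.log n) 3
    rw [Real.exp_log (by linarith)] at this
    exact_mod_cast this
  rw [Real.exp_neg, h, le_div_iff₀ (by linarith)]
  have : (n : ℝ) * ((n : ℝ) ^ 3)⁻¹ * n = (n : ℝ)⁻¹ := by field_simp
  rw [this]
  exact inv_le_one_of_one_le₀ hn'

end Numerics

/-! ### Exact recovery -/

/-- Non-asymptotic form of the exact recovery guarantee. -/
theorem IsBSBM.one_sub_le_measureReal_loss_lloyd {n₁ n₂ : ℕ} (hn₁ : 100 ≤ n₁) (hn₂ : 2 ≤ n₂)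
    {δ p γ₁ γ₂ : ℝ} (hδ : δ ∈ Set.Ioo (0 : ℝ) 2) (hδ1 : δ ≠ 1) (hp : p ∈ Set.Ioo (0 : ℝ) (1 / 2))
    (hγ : γ₁ * γ₂ ≤ 1 / 480)
    (hsnr : 20000000 * ((δ - 1) ^ 2)⁻¹ *
      max (Real.sqrt (Real.log n₁ / ((n₁ : ℝ) * (n₂ : ℝ)))) (Real.log n₁ / (n₂ : ℝ)) ≤ p)
    {η₁ : Fin n₁ → ℝ} {η₂ : Fin n₂ → ℝ} (h₁ : IsLabeling η₁) (h₂ : IsLabeling η₂)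
    (hi₁ : imbalance η₁ ≤ γ₁) (hi₂ : imbalance η₂ ≤ γ₂) {Ω : Type*} [MeasurableSpace Ω]
    {P : Measure Ω} [IsProbabilityMeasure P] {A : Ω → Matrix (Fin n₁) (Fin n₂) ℝ}
    (hA : IsBSBM P A η₁ η₂ δ p) {s₀ : ℝ} (hs₀ : s₀ = 1 ∨ s₀ = -1)
    {v : Matrix (Fin n₁) (Fin n₂) ℝ → Fin n₁ → ℝ}
    (hv : ∀ B, IsTopEigenvector (hollowedGram B) (v B)) {m : ℕ}
    (hm : Real.log n₁ / (2 * Real.log 2) - 3 / 2 < (m : ℝ)) :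
    1 - 8 / n₁ ≤ P.real {ω | loss η₁ (lloyd s₀ (A ω) (v (A ω)) m) = 0} := by
  have hn₁' : (100 : ℝ) ≤ n₁ := by exact_mod_cast hn₁
  have hn₂' : (2 : ℝ) ≤ n₂ := by exact_mod_cast hn₂
  have hp0 := hp.1
  have hL : 0 < Real.log n₁ := Real.log_pos (by linarith)
  obtain ⟨b1, b2, b3, b4⟩ := signal_bounds (by omega) hn₂ hδ hδ1 hp.1 hsnr
  have ha : (δ - 1) * p ≠ 0 := mul_ne_zero (sub_ne_zero.2 hδ1) hp0.ne'
  set s := ((δ - 1) * p) ^ 2 * n₂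
  have hs : 0 < s := by positivity
  have ht : 0 < s * n₁ / 500 := by positivity
  have ht' : 0 < |(δ - 1) * p| * n₂ / 500 := by positivity
  have b1' : 6 * Real.log n₁ / (s * n₁ / 500) * (1 + 8 * n₁ * p) ≤ 1 := by
    rw [div_mul_eq_mul_div, div_le_one ht]
    exact b1
  have b3' : 6 * Real.log n₁ / (|(δ - 1) * p| * n₂ / 500) ≤ 1 := (div_le_one ht').2 b3
  have p1 := hA.measureReal_quadForm_le hδ hp hL ht b1' b2
  have p2 := hA.measureReal_noiseGram_mulVec_le hδ hp hL ht b1' b2 fun i => (h₁.abs_eq i).le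
  have p3 := hA.measureReal_noise_mulVec_le hδ hp hL ht' b3' b4 (x := fun _ => 1) (by simp)
  have p4 := hA.measureReal_noise_mulVec_le hδ hp hL ht' b3' b4 fun k => (h₂.abs_eq k).le
  set E1 := {ω | ¬ ∀ x, |x ⬝ᵥ noiseGram η₁ η₂ δ p (A ω) *ᵥ x| ≤ s * n₁ / 500 * (x ⬝ᵥ x)}
  set E2 := {ω | ¬ ∀ i, |(noiseGram η₁ η₂ δ p (A ω) *ᵥ η₁) i| ≤ s * n₁ / 500}
  set E3 := {ω | ¬ ∀ i, |(noise η₁ η₂ δ p (A ω) *ᵥ fun _ => 1) i| ≤ |(δ - 1) * p| * n₂ / 500}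
  set E4 := {ω | ¬ ∀ i, |(noise η₁ η₂ δ p (A ω) *ᵥ η₂) i| ≤ |(δ - 1) * p| * n₂ / 500}
  set R := {ω | loss η₁ (lloyd s₀ (A ω) (v (A ω)) m) = 0}
  -- Covering the whole space and using subadditivity bounds P(R) from below without measurability
  -- of R, which is not available for an arbitrary choice of v.
  have hcover : (Set.univ : Set Ω) ⊆ R ∪ (E1 ∪ E2 ∪ (E3 ∪ E4)) := by
    intro ω _
    by_contra hω
    simp only [Set.mem_union, not_or] at hω
    obtain ⟨hR, ⟨h1, h2⟩, h3, h4⟩ := hω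
    refine hR (loss_lloyd_eq_zero (D := Matrix.of fun i j => hollowedGram (A ω) i j -
      s * (η₁ i * η₁ j) - noiseGram η₁ η₂ δ p (A ω) i j) h₁ hn₁ hs (hollowedGram_isSymm _)
      (fun i j => by rw [Matrix.of_apply]; ring) (fun i j => ?_) (noiseGram_isSymm _)
      (not_not.1 h1) (not_not.1 h2) hs₀ (hv _) hm)
    exact abs_hollowedGram_sub_le h₁ h₂ (by omega) (by omega) hγ hi₁ hi₂ (not_not.1 h3)
      (not_not.1 h4) i j
  have htot : (1 : ℝ) ≤ P.real R + ((P.real E1 + P.real E2) + (P.real E3 + P.real E4)) := by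
    calc (1 : ℝ) = P.real Set.univ := by simp
      _ ≤ P.real (R ∪ (E1 ∪ E2 ∪ (E3 ∪ E4))) := measureReal_mono hcover
      _ ≤ P.real R + P.real (E1 ∪ E2 ∪ (E3 ∪ E4)) := measureReal_union_le _ _
      _ ≤ _ := by
        refine add_le_add le_rfl ((measureReal_union_le _ _).trans ?_)
        exact add_le_add (measureReal_union_le _ _) (measureReal_union_le _ _)
  -- Each of the four bad events has probability at most 2n₁exp(-3 log n₁) ≤ 2/n₁, which gives 8/n₁
  -- in total.
  have hfin := natCast_mul_exp_neg_log_le (n := n₁) (by omega)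
  have h8 : (8 : ℝ) / n₁ = 8 * (1 / n₁) := by ring
  rw [h8]
  linarith

end BSBM

end

theorem theorem2 :
    ∃ C : ℝ, 0 < C ∧ ∀ ε : ℝ, 0 < ε → ∃ N : ℕ, ∀ n₁ n₂ : ℕ, N ≤ n₁ → 2 ≤ n₁ → 2 ≤ n₂ →
      ∀ δ p γ₁ γ₂ : ℝ, δ ∈ Set.Ioo (0 : ℝ) 2 → δ ≠ 1 → p ∈ Set.Ioo (0 : ℝ) (1 / 2) →
      γ₁ ∈ Set.Ioo (0 : ℝ) 1 → γ₂ ∈ Set.Ioo (0 : ℝ) 1 → γ₁ * γ₂ ≤ 1 / 480 →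
      C * ((δ - 1) ^ 2)⁻¹ *
          max (Real.sqrt (Real.log n₁ / ((n₁ : ℝ) * (n₂ : ℝ)))) (Real.log n₁ / (n₂ : ℝ)) ≤ p →
      ∀ (η₁ : Fin n₁ → ℝ) (η₂ : Fin n₂ → ℝ), BSBM.IsLabeling η₁ → BSBM.IsLabeling η₂ →
      BSBM.imbalance η₁ ≤ γ₁ → BSBM.imbalance η₂ ≤ γ₂ →
      ∀ (Ω : Type*) [MeasurableSpace Ω] (P : Measure Ω) [IsProbabilityMeasure P]
        (A : Ω → Matrix (Fin n₁) (Fin n₂) ℝ), BSBM.IsBSBM P A η₁ η₂ δ p →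
      ∀ s₀ : ℝ, (s₀ = 1 ∨ s₀ = -1) →
      ∀ v : Matrix (Fin n₁) (Fin n₂) ℝ → Fin n₁ → ℝ,
        (∀ B, BSBM.IsTopEigenvector (BSBM.hollowedGram B) (v B)) →
      ∀ m : ℕ, Real.log n₁ / (2 * Real.log 2) - 3 / 2 < (m : ℝ) →
        1 - ε ≤ P.real {ω | BSBM.loss η₁ (BSBM.lloyd s₀ (A ω) (v (A ω)) m) = 0} := by
  refine ⟨20000000, by norm_num, fun ε hε => ?_⟩
  obtain ⟨N, hN⟩ := exists_nat_ge (8 / ε)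
  refine ⟨max 100 N, fun n₁ n₂ hn _ hn₂ δ p γ₁ γ₂ hδ hδ1 hp _ _ hγ hsnr η₁ η₂ h₁ h₂ hi₁ hi₂ Ω _ P _
    A hA s₀ hs₀ v hv m hm => ?_⟩
  have hn100 : 100 ≤ n₁ := (le_max_left _ _).trans hn
  have hnN : (N : ℝ) ≤ n₁ := by exact_mod_cast (le_max_right _ _).trans hn
  have hn0 : (0 : ℝ) < n₁ := by
    have : (100 : ℝ) ≤ n₁ := by exact_mod_cast hn100
    linarith
  have hε' : 8 / (n₁ : ℝ) ≤ ε := by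
    rw [div_le_iff₀ hn0, mul_comm, ← div_le_iff₀ hε]
    exact hN.trans hnN
  have := hA.one_sub_le_measureReal_loss_lloyd hn100 hn₂ hδ hδ1 hp hγ hsnr h₁ h₂ hi₁ hi₂ hs₀ hv hm
  linarith
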